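/- Let $\mathcal O$ be the sheaf of holomorphic functions on $\mathbb P^1=\mathbb P^1(\mathbb C)$ and let $\mathcal E\simeq\bigoplus_{j=1}^n\mathcal O(a_j)$ be a holomorphic vector bundle on $\mathbb P^1$ (a locally free sheaf of $\mathcal O$-modules of finite rank), whose type, i.e. the decreasing sequence $(a_1,\dots,a_n)$, is written as $$(\underbrace{\alpha_1,\dots,\alpha_1}_{n_1\text{ times}},\underbrace{\alpha_2,\dots,\alpha_2}_{n_2\text{ times}},\dots,\underbrace{\alpha_s,\dots,\alpha_s}_{n_s\text{ times}}),\qquad \alpha_1>\alpha_2>\cdots>\alpha_s .$$ Let $x\in\mathbb P^1$, let $\mathcal O_x$ be the local ring at $x$ with maximal ideal $\mathfrak m_x$, and let $\tilde\Lambda$ be an $\mathcal O_x$-lattice with $\mathfrak m_x\mathcal E_x\subset\tilde\Lambda\subset\mathcal E_x$. Let $\mathcal E^{\tilde\Lambda}\subset\mathcal E$ be the modified bundle, which coincides with $\mathcal E$ on $\mathbb P^1\setminus\{x\}$ and has stalk $\tilde\Lambda$ at $x$. Let $E=\mathcal E_x/\mathfrak m_x\mathcal E_x$ be the fibre at $x$,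 and let $W=\tilde\Lambda/\mathfrak m_x\mathcal E_x\subset E$. The Harder–Narasimhan filtration of $\mathcal E$ is $F^k(\mathcal E)=\bigoplus_{j:\,a_j\ge k}\mathcal L_j$ for $k\in\mathbb Z$, where $\mathcal E=\bigoplus_j\mathcal L_j$ is any decomposition with $\mathcal L_j\simeq\mathcal O(a_j)$. Let $0=F_0\subset F_1\subset\cdots\subset F_s=E$ be the flag that it induces in the fibre: $F_i$ is the image of $F^{\alpha_i}(\mathcal E)_x$ in $E$. Put $$m_i=\dim_{\mathbb C}(F_i\cap W)-\dim_{\mathbb C}(F_{i-1}\cap W),\qquad 1\le i\le s .$$ Then $0\le m_i\le n_i$ for all $i$, and the bundle $\mathcal E^{\tilde\Lambda}$ has type $$(\underbrace{\alpha_1,\dots,\alpha_1}_{m_1\text{ times}},\underbrace{\alpha_1-1,\dots,\alpha_1-1}_{n_1-m_1\text{ times}},\dots,\underbrace{\alpha_s,\dots,\alpha_s}_{m_s\text{ times}},\underbrace{\alpha_s-1,\dots,\alpha_s-1}_{n_s-m_s\text{ times}}),$$ that is, this sequence is decreasing and $\mathcal E^{\tilde\Lambda}$ is isomorphic to the direct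 sum of the corresponding line bundles. -/

import Mathlib

open CategoryTheory CategoryTheory.Limits TopologicalSpace Opposite Filter Topology

noncomputable section

namespace RiemannSphere

/-- The Riemann sphere `ℙ¹(ℂ) = ℂ ∪ {∞}`. -/
abbrev P1 : TopCat.{0} := TopCat.of (OnePoint ℂ)

/-- Being holomorphic at `p`, for a section `f` of the line bundle of degree `a`.

The line bundle is trivial on `ℂ` (coordinate `z`) and on `ℙ¹ \ {0}` (coordinate `w = 1 / z`), and a
section is a pair `(f₀, f₁)` of functions on these two charts with `f₀ = z ^ a * f₁` on the overlap.
The pair is stored as the one function `f` that is `f₀` on `ℂ` and `f₁` at `∞`, so that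
`f₁ = w ^ a * f₀` off `∞`. For `a = 0`, this says that the function `f` is holomorphic at `p`. -/
def IsHolAt (a : ℤ) (f : OnePoint ℂ → ℂ) (p : OnePoint ℂ) : Prop :=
  (∀ z : ℂ, p = (z : OnePoint ℂ) → AnalyticAt ℂ (fun w : ℂ => f (w : OnePoint ℂ)) z) ∧
  (p = OnePoint.infty → AnalyticAt ℂ
    (fun w : ℂ => if w = 0 then f OnePoint.infty else w ^ a * f ((w⁻¹ : ℂ) : OnePoint ℂ)) 0)

theorem IsHolAt.congr {a : ℤ} {f g : OnePoint ℂ → ℂ} {p : OnePoint ℂ}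
    (hf : IsHolAt a f p) (h : f =ᶠ[𝓝 p] g) : IsHolAt a g p := by
  refine ⟨fun z hz => ?_, fun hp => ?_⟩
  · subst hz
    exact (hf.1 z rfl).congr (OnePoint.continuous_coe.continuousAt.eventually h)
  · subst hp
    refine (hf.2 rfl).congr ?_
    have h0 : f OnePoint.infty = g OnePoint.infty := h.self_of_nhds
    have ht : Tendsto (fun w : ℂ => ((w⁻¹ : ℂ) : OnePoint ℂ)) (𝓝[≠] 0) (𝓝 OnePoint.infty) := by
      have h1 : Tendsto (fun w : ℂ => w⁻¹) (𝓝[≠] 0) (coclosedCompact ℂ) := by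
        rw [coclosedCompact_eq_cocompact, ← Metric.cobounded_eq_cocompact]
        exact tendsto_inv₀_nhdsNE_zero
      have h2 : Tendsto ((↑) : ℂ → OnePoint ℂ) (coclosedCompact ℂ) (𝓝 OnePoint.infty) :=
        OnePoint.tendsto_coe_infty
      exact h2.comp h1
    have h3 := eventually_nhdsWithin_iff.1 (ht.eventually h)
    filter_upwards [h3] with w hw
    by_cases hw0 : w = 0
    · simp [hw0, h0]
    · simp only [hw0, if_false]
      rw [hw hw0]

theorem IsHolAt.add {a : ℤ} {f g : OnePoint ℂ → ℂ} {p : OnePoint ℂ}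
    (hf : IsHolAt a f p) (hg : IsHolAt a g p) : IsHolAt a (f + g) p := by
  refine ⟨fun z hz => (hf.1 z hz).add (hg.1 z hz), fun hp => ?_⟩
  refine ((hf.2 hp).add (hg.2 hp)).congr (Eventually.of_forall fun w => ?_)
  by_cases hw : w = 0 <;> simp [hw, mul_add]

theorem IsHolAt.mul {a b : ℤ} {f g : OnePoint ℂ → ℂ} {p : OnePoint ℂ}
    (hf : IsHolAt a f p) (hg : IsHolAt b g p) : IsHolAt (a + b) (f * g) p := by
  refine ⟨fun z hz => (hf.1 z hz).mul (hg.1 z hz), fun hp => ?_⟩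
  refine ((hf.2 hp).mul (hg.2 hp)).congr (Eventually.of_forall fun w => ?_)
  by_cases hw : w = 0
  · simp [hw]
  · simp only [Pi.mul_apply, hw, if_false, zpow_add₀ hw]
    ring

theorem isHolAt_const (c : ℂ) (p : OnePoint ℂ) : IsHolAt 0 (fun _ => c) p := by
  refine ⟨fun z _ => analyticAt_const, fun _ => ?_⟩
  refine (analyticAt_const (v := c)).congr (Eventually.of_forall fun w => ?_)
  by_cases hw : w = 0 <;> simp [hw]

theorem isHolAt_zero (a : ℤ) (p : OnePoint ℂ) : IsHolAt a 0 p := by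
  refine ⟨fun z _ => analyticAt_const, fun _ => ?_⟩
  refine (analyticAt_const (v := (0 : ℂ))).congr (Eventually.of_forall fun w => ?_)
  simp

/-- Extension by zero of a function on an open set. -/
def ext0 {U : Opens P1} (f : U → ℂ) : OnePoint ℂ → ℂ := Function.extend Subtype.val f 0

theorem ext0_apply {U : Opens P1} (f : U → ℂ) (p : U) : ext0 f p.1 = f p :=
  Subtype.val_injective.extend_apply f 0 p

theorem ext0_eventuallyEq {U : Opens P1} (f : U → ℂ) (g : OnePoint ℂ → ℂ)
    (h : ∀ p : U, g p.1 = f p) {p : OnePoint ℂ} (hp : p ∈ U) : g =ᶠ[𝓝 p] ext0 f := by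
  filter_upwards [U.isOpen.mem_nhds hp] with q hq
  rw [h ⟨q, hq⟩]
  exact (ext0_apply f ⟨q, hq⟩).symm

/-- Being a holomorphic section over `U` of the line bundle of degree `a`: a local condition. -/
def holPred (a : ℤ) : TopCat.LocalPredicate (fun _ : P1 => ℂ) where
  pred {U} f := ∀ p ∈ U, IsHolAt a (ext0 f) p
  res {U V} i f hf p hp := (hf p (i.le hp)).congr
    (ext0_eventuallyEq _ _ (fun q => ext0_apply f ⟨q.1, i.le q.2⟩) hp)
  locality {U} f h p hp := by
    obtain ⟨V, hV, i, hf⟩ := h ⟨p, hp⟩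
    exact (hf p hV).congr
      (ext0_eventuallyEq (fun x : V => f ⟨x.1, i.le x.2⟩) (ext0 f)
        (fun q => ext0_apply f ⟨q.1, i.le q.2⟩) hV).symm

/-- `Γ(U, 𝒪(a))`, as a group of functions on `U`. -/
def secGroup (a : ℤ) (U : Opens P1) : AddSubgroup (U → ℂ) where
  carrier := {f | (holPred a).pred f}
  zero_mem' p hp := (isHolAt_zero a p).congr (ext0_eventuallyEq _ _ (fun _ => rfl) hp)
  add_mem' {f g} hf hg p hp := ((hf p hp).add (hg p hp)).congr
    (ext0_eventuallyEq _ _ (fun q => by simp [ext0_apply]) hp)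
  neg_mem' {f} hf p hp := by
    have := (isHolAt_const (-1) p).mul (hf p hp)
    rw [zero_add] at this
    exact this.congr (ext0_eventuallyEq _ _ (fun q => by simp [ext0_apply]) hp)

theorem mul_mem_secGroup {a b c : ℤ} (h : a + b = c) {U : Opens P1} {f g : U → ℂ}
    (hf : f ∈ secGroup a U) (hg : g ∈ secGroup b U) : f * g ∈ secGroup c U := by
  subst h
  exact fun p hp => ((hf p hp).mul (hg p hp)).congr
    (ext0_eventuallyEq _ _ (fun q => by simp [ext0_apply]) hp)

theorem const_mem_secGroup (c : ℂ) (U : Opens P1) : (fun _ => c) ∈ secGroup 0 U :=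
  fun p hp => (isHolAt_const c p).congr (ext0_eventuallyEq _ _ (fun _ => rfl) hp)

/-- `Γ(U, 𝒪)`, the ring of holomorphic functions on `U`. -/
def secRing (U : Opens P1) : Subring (U → ℂ) where
  __ := secGroup 0 U
  one_mem' := const_mem_secGroup 1 U
  mul_mem' := mul_mem_secGroup (zero_add 0)

theorem res_mem_secGroup {a : ℤ} {U V : Opens P1} (i : U ⟶ V) {f : V → ℂ}
    (hf : f ∈ secGroup a V) : (fun x : U => f ⟨x.1, i.le x.2⟩) ∈ secGroup a U :=
  (holPred a).res i f hf

/-- The presheaf of rings of holomorphic functions on `ℙ¹`. -/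
def presheafO : TopCat.Presheaf CommRingCat.{0} P1 where
  obj U := CommRingCat.of (secRing U.unop)
  map {U V} i := CommRingCat.ofHom
    { toFun := fun f => ⟨fun x => f.1 ⟨x.1, i.unop.le x.2⟩, res_mem_secGroup i.unop f.2⟩
      map_one' := rfl
      map_mul' := fun _ _ => rfl
      map_zero' := rfl
      map_add' := fun _ _ => rfl }

theorem presheafO_isSheaf : presheafO.IsSheaf :=
  (TopCat.Presheaf.isSheaf_iff_isSheaf_comp (forget CommRingCat) presheafO).mpr
    (TopCat.subpresheafToTypes.isSheaf (holPred 0))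

/-- The structure sheaf `𝒪` of the Riemann sphere. -/
def sheafO : TopCat.Sheaf CommRingCat.{0} P1 := ⟨presheafO, presheafO_isSheaf⟩

/-- `𝒪` as a sheaf of (not necessarily commutative) rings, the form Mathlib's modules take. -/
abbrev ringSheafO : Sheaf (Opens.grothendieckTopology P1) RingCat.{0} :=
  ⟨presheafO ⋙ forget₂ CommRingCat RingCat,
    ((sheafCompose _ (forget₂ CommRingCat RingCat.{0})).obj sheafO).property⟩

/-- Sheaves of `𝒪`-modules on the Riemann sphere. -/
abbrev OMod := SheafOfModules.{0} ringSheafO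

instance secModule (a : ℤ) (U : Opens P1) : Module (secRing U) (secGroup a U) where
  smul r f := ⟨r.1 * f.1, mul_mem_secGroup (zero_add a) r.2 f.2⟩
  one_smul f := Subtype.ext (one_mul f.1)
  mul_smul r s f := Subtype.ext (mul_assoc r.1 s.1 f.1)
  smul_zero r := Subtype.ext (mul_zero r.1)
  smul_add r f g := Subtype.ext (mul_add r.1 f.1 g.1)
  add_smul r s f := Subtype.ext (add_mul r.1 s.1 f.1)
  zero_smul f := Subtype.ext (zero_mul f.1)

/-- The presheaf of groups underlying `𝒪(a)`. -/
def lineBundleAb (a : ℤ) : TopCat.Presheaf Ab.{0} P1 where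
  obj U := AddCommGrpCat.of (secGroup a U.unop)
  map {U V} i := AddCommGrpCat.ofHom
    { toFun := fun f => ⟨fun x => f.1 ⟨x.1, i.unop.le x.2⟩, res_mem_secGroup i.unop f.2⟩
      map_zero' := rfl
      map_add' := fun _ _ => rfl }

instance (a : ℤ) (U : (Opens P1)ᵒᵖ) :
    Module (ringSheafO.obj.obj U) ((lineBundleAb a).obj U) :=
  secModule a U.unop

/-- The line bundle `𝒪(a)` of degree `a` on the Riemann sphere. -/
def lineBundle (a : ℤ) : OMod where
  val := PresheafOfModules.ofPresheaf (lineBundleAb a) (by intros; rfl)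
  isSheaf := (TopCat.Presheaf.isSheaf_iff_isSheaf_comp (forget Ab) (lineBundleAb a)).mpr
    (TopCat.subpresheafToTypes.isSheaf (holPred a))

/-! ### Stalks and fibres -/

/-- Constant functions as holomorphic functions on `U`. -/
def constHom (U : Opens P1) : ℂ →+* secRing U where
  toFun c := ⟨fun _ => c, const_mem_secGroup c U⟩
  map_one' := rfl
  map_mul' _ _ := rfl
  map_zero' := rfl
  map_add' _ _ := rfl

/-- The local ring `𝒪_x` of germs of holomorphic functions at `x`. -/
abbrev StalkO (x : P1) : Type := (presheafO.stalk x : CommRingCat.{0})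

/-- `𝒪_x` is a `ℂ`-algebra through the germs of constant functions. -/
instance (x : P1) : Algebra ℂ (StalkO x) :=
  ((presheafO.germ ⊤ x trivial).hom.comp (constHom ⊤)).toAlgebra

/-- The maximal ideal `𝔪_x` of `𝒪_x`: the germs of the functions that vanish at `x`. -/
def maxIdeal (x : P1) : Ideal (StalkO x) :=
  Ideal.span {g | ∃ (U : Opens P1) (hx : x ∈ U) (f : secRing U),
    f.1 ⟨x, hx⟩ = 0 ∧ presheafO.germ U x hx f = g}

/-- The stalk `ℰ_x` of a sheaf of `𝒪`-modules, an `𝒪_x`-module. -/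
abbrev Stalk (E : OMod) (x : P1) : Type :=
  (TopCat.Presheaf.stalk (C := Ab.{0}) (X := P1) E.val.presheaf x : Ab.{0})

instance stalkModule (E : OMod) (x : P1) : Module (StalkO x) (Stalk E x) :=
  PresheafOfModules.instModuleCarrierStalkCommRingCatCarrierAbPresheafOpensCarrier
    (R := presheafO) E.val x

/-- The germ at `x` of a section of `ℰ` over `U`. -/
def germ (E : OMod) (U : Opens P1) {x : P1} (hx : x ∈ U) : E.val.obj (op U) →+ Stalk E x :=
  (TopCat.Presheaf.germ (C := Ab.{0}) (X := P1) E.val.presheaf U x hx).hom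

theorem germ_smul (E : OMod) (U : Opens P1) {x : P1} (hx : x ∈ U) (r : secRing U)
    (s : E.val.obj (op U)) :
    germ E U hx ((show ringSheafO.obj.obj (op U) from r) • s) =
      (show StalkO x from presheafO.germ U x hx r) • germ E U hx s :=
  PresheafOfModules.germ_smul (R := presheafO) E.val x U hx r s

theorem germ_res (E : OMod) {U V : Opens P1} (i : U ⟶ V) {x : P1} (hx : x ∈ U)
    (s : E.val.obj (op V)) : germ E U hx (E.val.map i.op s) = germ E V (i.le hx) s :=
  TopCat.Presheaf.germ_res_apply (C := Ab.{0}) (X := P1) E.val.presheaf i x hx s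

instance stalkModuleC (E : OMod) (x : P1) : Module ℂ (Stalk E x) :=
  Module.compHom _ (algebraMap ℂ (StalkO x))

instance (E : OMod) (x : P1) : IsScalarTower ℂ (StalkO x) (Stalk E x) :=
  IsScalarTower.of_algebraMap_smul fun _ _ => rfl

/-- The fibre `ℰ_x / 𝔪_x ℰ_x`. -/
abbrev Fibre (E : OMod) (x : P1) : Type :=
  Stalk E x ⧸ (maxIdeal x • (⊤ : Submodule (StalkO x) (Stalk E x)))

/-- The projection `ℰ_x → ℰ_x / 𝔪_x ℰ_x`. -/
abbrev toFibre (E : OMod) (x : P1) : Stalk E x →ₗ[StalkO x] Fibre E x :=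
  Submodule.mkQ _

/-- The stalk at `x` of a subpresheaf of modules of `ℰ`, inside `ℰ_x`. -/
def subStalk {E : OMod} (N : E.val.Submodule) (x : P1) : Submodule (StalkO x) (Stalk E x) :=
  Submodule.span _ {m | ∃ (U : Opens P1) (hx : x ∈ U) (s : E.val.obj (op U)),
    s ∈ N.obj (op U) ∧ germ E U hx s = m}

/-! ### Direct sums of line bundles -/

instance : HasFiniteBiproducts OMod := Abelian.hasFiniteBiproducts

/-- The bundle `⨁ᵢ 𝒪(aᵢ)`. -/
def splitBundle {n : ℕ} (a : Fin n → ℤ) : OMod := ⨁ fun i => lineBundle (a i)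

/-- `ℰ` has type `a`: the sequence `a` is decreasing and `ℰ ≃ ⨁ᵢ 𝒪(aᵢ)`. -/
def HasType (E : OMod) {n : ℕ} (a : Fin n → ℤ) : Prop :=
  Antitone a ∧ Nonempty (E ≅ splitBundle a)

/-- The summand `ℒᵢ ≃ 𝒪(aᵢ)` of `ℰ` given by a decomposition `ℰ ≃ ⨁ᵢ 𝒪(aᵢ)`. -/
def summand {E : OMod} {n : ℕ} {a : Fin n → ℤ} (φ : E ≅ splitBundle a) (i : Fin n) :
    lineBundle (a i) ⟶ E :=
  biproduct.ι (fun i => lineBundle (a i)) i ≫ φ.inv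

/-- The step `F^k(ℰ) = ⨁_{i : aᵢ ≥ k} ℒᵢ` of the Harder-Narasimhan filtration of `ℰ`. -/
def hn {E : OMod} {n : ℕ} {a : Fin n → ℤ} (φ : E ≅ splitBundle a) (k : ℤ) : E.val.Submodule where
  obj U := ⨆ (i : Fin n) (_ : k ≤ a i), LinearMap.range ((summand φ i).val.app U).hom
  map {U V} f := iSup₂_le fun i hi => by
    rintro _ ⟨s, rfl⟩
    refine Submodule.mem_iSup_of_mem i
      (Submodule.mem_iSup_of_mem hi ⟨(lineBundle (a i)).val.map f s, ?_⟩)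
    exact PresheafOfModules.naturality_apply (summand φ i).val f s

/-- The sequence of length `∑ νᵢ` made of consecutive blocks, `(c i 0, …, c i (νᵢ - 1))` being the
`i`-th one. -/
def blockSeq {s : ℕ} (ν : Fin s → ℕ) (c : (i : Fin s) → Fin (ν i) → ℤ) : Fin (∑ i, ν i) → ℤ :=
  fun j => c (finSigmaFinEquiv.symm j).1 (finSigmaFinEquiv.symm j).2

/-- The flag `0 = F₀ ⊆ F₁ ⊆ ⋯ ⊆ F_s` induced by the Harder-Narasimhan filtration in the fibre at
`x`: for the distinct values `α₁ > ⋯ > α_s` of the type, `Fᵢ` is the image of the stalk of the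
step `F^{αᵢ}(ℰ)`. -/
def hnFlag {E : OMod} {n : ℕ} {a : Fin n → ℤ} (φ : E ≅ splitBundle a) {s : ℕ} (α : Fin s → ℤ)
    (x : P1) : Fin (s + 1) → Submodule (StalkO x) (Fibre E x) :=
  Fin.cons ⊥ fun i => (subStalk (hn φ (α i)) x).map (toFibre E x)

/-- `dim_ℂ (Fᵢ ∩ W)`, where `W` is the image of `Λ` in the fibre at `x`. -/
def flagDim {E : OMod} {n : ℕ} {a : Fin n → ℤ} (φ : E ≅ splitBundle a) {s : ℕ} (α : Fin s → ℤ)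
    {x : P1} (Λ : Submodule (StalkO x) (Stalk E x)) (i : Fin (s + 1)) : ℕ :=
  Module.finrank ℂ ↥(hnFlag φ α x i ⊓ Λ.map (toFibre E x))

/-- `mᵢ = dim_ℂ (Fᵢ ∩ W) - dim_ℂ (Fᵢ₋₁ ∩ W)`. -/
def flagMult {E : OMod} {n : ℕ} {a : Fin n → ℤ} (φ : E ≅ splitBundle a) {s : ℕ} (α : Fin s → ℤ)
    {x : P1} (Λ : Submodule (StalkO x) (Stalk E x)) (i : Fin s) : ℕ :=
  flagDim φ α Λ i.succ - flagDim φ α Λ i.castSucc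

/-! ### Modification of a bundle at a point -/

/-- The sections of `ℰ` whose germ at `x` (if they have one) lies in `Λ`. -/
def modifySub (E : OMod) (x : P1) (Λ : Submodule (StalkO x) (Stalk E x)) : E.val.Submodule where
  obj U :=
    { carrier := {s | ∀ hx : x ∈ U.unop, germ E U.unop hx s ∈ Λ}
      zero_mem' := fun hx => by
        rw [map_zero]
        exact Λ.zero_mem
      add_mem' := fun {s t} hs ht hx => by
        rw [map_add]
        exact Λ.add_mem (hs hx) (ht hx)
      smul_mem' := fun r s hs hx =>
        (germ_smul E U.unop hx r s).symm ▸ Λ.smul_mem _ (hs hx) }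
  map {U V} f s hs hx := (germ_res E f.unop hx s).symm ▸ hs (f.unop.le hx)

/-- The modified bundle `ℰ^Λ`: it is `ℰ` away from `x` and has stalk `Λ` at `x`. -/
def modify (E : OMod) (x : P1) (Λ : Submodule (StalkO x) (Stalk E x)) : OMod where
  val := (modifySub E x Λ).toPresheafOfModules
  isSheaf := by
    refine (TopCat.Presheaf.isSheaf_iff_isSheaf_comp (X := P1) (forget Ab.{0}) _).mpr ?_
    refine TopCat.Presheaf.isSheaf_of_isSheafUniqueGluing_types _ fun ι U sf hsf => ?_
    let sf' (i : ι) : E.val.obj (op (U i)) := (sf i).1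
    have hsf' : TopCat.Presheaf.IsCompatible (C := Ab.{0}) (X := P1) E.val.presheaf U sf' :=
      fun i j => congrArg Subtype.val (hsf i j)
    obtain ⟨s, hs, hu⟩ := TopCat.Sheaf.existsUnique_gluing (C := Ab.{0}) (X := P1)
      ⟨E.val.presheaf, E.isSheaf⟩ U sf' hsf'
    refine ⟨⟨s, ?_⟩, fun i => Subtype.ext (hs i), fun t ht =>
      Subtype.ext (hu t.1 fun i => congrArg Subtype.val (ht i))⟩
    intro hx
    obtain ⟨i, hi⟩ := Opens.mem_iSup.mp hx
    have h1 := (sf i).2 hi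
    have h2 := germ_res E (Opens.leSupr U i) hi s
    have h3 : E.val.map (Opens.leSupr U i).op s = sf' i := hs i
    rw [h3] at h2
    exact h2 ▸ h1

end RiemannSphere

end

/-! A splitting `φ` identifies the fibre at `x` with `ℂⁿ`, the induced flag with the coordinate flag
of the blocks, and `Λ`, which contains `𝔪_x ℰ_x`, with the preimage of a subspace `W` of `ℂⁿ`. If
`W` is spanned by coordinate vectors, the claim is clear: a summand `𝒪(aⱼ)` whose vector lies in `W`
survives, and any other is replaced by its sections vanishing at `x`, a copy of `𝒪(aⱼ - 1)`.

The general case reduces to this one by an automorphism of the bundle. Linear algebra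
(`exists_blockTriangular_adapted`) gives an invertible block triangular matrix `c` such that the
first `mᵢ` columns of each block `i` lie in `W` and together span it. Triangularity means that `c k
j ≠ 0` forces `a j ≤ a k`, so `c k j * σ ^ (a k - a j)` is a global section of `𝒪(a k - a j)`, where
`σ` is a section of `𝒪(1)` with `σ x = 1`. These entries form an endomorphism with value `c` at `x`.
The inverse of `c` is triangular too and twisting respects products (`sum_twist_mul_twist`), so this
is an automorphism. `nonempty_iso_splitBundle` composes it with multiplication by `1` or by
`pointSec x` on each summand, and shows that the result maps bijectively onto the sections of `ℰ^Λ`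
over every open set. -/

noncomputable section

namespace RiemannSphere

/-! ### Sections of `𝒪(1)` vanishing at a point, and division by them -/

/-- The section of `𝒪(1)` that vanishes exactly at `q`. -/
def pointSec (q p : OnePoint ℂ) : ℂ :=
  q.elim (p.elim 0 fun _ => 1) fun b => p.elim 1 fun z => z - b

theorem pointSec_eq_zero_iff {q p : OnePoint ℂ} : pointSec q p = 0 ↔ p = q := by
  induction q using OnePoint.rec with
  | infty =>
    induction p using OnePoint.rec with
    | infty => simp [pointSec]
    | coe z => simp [pointSec]
  | coe b =>
    induction p using OnePoint.rec with
    | infty => simp [pointSec]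
    | coe z => simp [pointSec, sub_eq_zero]

theorem isHolAt_pointSec (q p : OnePoint ℂ) : IsHolAt 1 (pointSec q) p := by
  induction q using OnePoint.rec with
  | infty =>
    refine ⟨fun z _ => analyticAt_const (v := (1 : ℂ)), fun _ => ?_⟩
    refine analyticAt_id.congr (Eventually.of_forall fun w => ?_)
    by_cases hw : w = 0 <;> simp [hw, pointSec]
  | coe b =>
    refine ⟨fun z _ => analyticAt_id.sub analyticAt_const, fun _ => ?_⟩
    refine (analyticAt_const.sub (analyticAt_const.mul analyticAt_id) :
      AnalyticAt ℂ (fun w : ℂ => 1 - b * w) 0).congr (Eventually.of_forall fun w => ?_)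
    by_cases hw : w = 0
    · simp [hw, pointSec]
    · simp only [pointSec, OnePoint.elim_some, OnePoint.elim_infty, hw, if_false]
      field_simp
      simp [mul_comm]

theorem IsHolAt.inv {a : ℤ} {f : OnePoint ℂ → ℂ} {p : OnePoint ℂ} (hf : IsHolAt a f p)
    (h0 : f p ≠ 0) : IsHolAt (-a) f⁻¹ p := by
  refine ⟨fun z hz => (hf.1 z hz).inv (hz ▸ h0), fun hp => ?_⟩
  refine ((hf.2 hp).inv (by simpa [← hp] using h0)).congr (Eventually.of_forall fun w => ?_)
  by_cases hw : w = 0 <;> simp [hw, mul_comm]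

theorem IsHolAt.pow {a : ℤ} {f : OnePoint ℂ → ℂ} {p : OnePoint ℂ} (hf : IsHolAt a f p) (n : ℕ) :
    IsHolAt (n * a) (f ^ n) p := by
  induction n with
  | zero =>
    rw [Nat.cast_zero, zero_mul, pow_zero]
    exact isHolAt_const 1 p
  | succ n ih => simpa [pow_succ, add_mul] using ih.mul hf

theorem IsHolAt.zpow {a : ℤ} {f : OnePoint ℂ → ℂ} {p : OnePoint ℂ} (hf : IsHolAt a f p)
    (h0 : f p ≠ 0) (n : ℤ) : IsHolAt (n * a) (f ^ n) p := by
  obtain ⟨n, rfl | rfl⟩ := n.eq_nat_or_neg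
  · simpa using hf.pow n
  · simpa using (hf.pow n).inv (by simp [h0])

theorem IsHolAt.const_smul {a : ℤ} {f : OnePoint ℂ → ℂ} {p : OnePoint ℂ} (hf : IsHolAt a f p)
    (c : ℂ) : IsHolAt a (fun q => c * f q) p := by
  have := (isHolAt_const c p).mul hf
  rwa [zero_add] at this

theorem tendsto_coe_punctured (z : ℂ) :
    Tendsto ((↑) : ℂ → OnePoint ℂ) (𝓝[≠] z) (𝓝[≠] (z : OnePoint ℂ)) :=
  tendsto_nhdsWithin_of_tendsto_nhds_of_eventually_within _
    (OnePoint.continuous_coe.continuousAt.tendsto.mono_left nhdsWithin_le_nhds)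
    (eventually_nhdsWithin_of_forall fun w hw => by simpa using hw)

theorem tendsto_coe_inv_punctured :
    Tendsto (fun w : ℂ => ((w⁻¹ : ℂ) : OnePoint ℂ)) (𝓝[≠] 0) (𝓝[≠] OnePoint.infty) := by
  have h1 : Tendsto (fun w : ℂ => w⁻¹) (𝓝[≠] 0) (coclosedCompact ℂ) := by
    rw [coclosedCompact_eq_cocompact, ← Metric.cobounded_eq_cocompact]
    exact tendsto_inv₀_nhdsNE_zero
  have h2 : Tendsto ((↑) : ℂ → OnePoint ℂ) (coclosedCompact ℂ) (𝓝 OnePoint.infty) :=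
    OnePoint.tendsto_coe_infty
  exact tendsto_nhdsWithin_of_tendsto_nhds_of_eventually_within _ (h2.comp h1)
    (Eventually.of_forall fun w => OnePoint.coe_ne_infty _)

theorem _root_.AnalyticAt.eq_zero_of_eventually_punctured {F : ℂ → ℂ} {z : ℂ}
    (hF : AnalyticAt ℂ F z) (h : ∀ᶠ w in 𝓝[≠] z, F w = 0) : F z = 0 :=
  tendsto_nhds_unique (hF.continuousAt.tendsto.mono_left nhdsWithin_le_nhds)
    (tendsto_const_nhds.congr' (h.mono fun _ hw => hw.symm))

theorem IsHolAt.eq_zero_of_eventually {a : ℤ} {f : OnePoint ℂ → ℂ} {p : OnePoint ℂ}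
    (hf : IsHolAt a f p) (h : ∀ᶠ q in 𝓝[≠] p, f q = 0) : f p = 0 := by
  induction p using OnePoint.rec with
  | infty =>
    have := (hf.2 rfl).eq_zero_of_eventually_punctured (by
      filter_upwards [tendsto_coe_inv_punctured.eventually h, self_mem_nhdsWithin] with w hw hw0
      simp_all)
    simpa using this
  | coe z =>
    exact (hf.1 z rfl).eq_zero_of_eventually_punctured ((tendsto_coe_punctured z).eventually h)

theorem _root_.AnalyticAt.dslope_self {F : ℂ → ℂ} {z : ℂ} (hF : AnalyticAt ℂ F z) :
    AnalyticAt ℂ (dslope F z) z :=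
  let ⟨_, hp⟩ := hF
  hp.has_fpower_series_dslope_fslope.analyticAt

/-- A section vanishing at `x` is divisible by `pointSec x`. -/
theorem exists_eq_pointSec_mul (a : ℤ) {x : OnePoint ℂ} {f : OnePoint ℂ → ℂ} (hfx : f x = 0) :
    ∃ g : OnePoint ℂ → ℂ, (∀ p, f p = pointSec x p * g p) ∧
      ∀ p, IsHolAt a f p → IsHolAt (a - 1) g p := by
  obtain ⟨g, hg, hx⟩ : ∃ g : OnePoint ℂ → ℂ, (∀ p, f p = pointSec x p * g p) ∧
      (IsHolAt a f x → IsHolAt (a - 1) g x) := by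
    induction x using OnePoint.rec with
    | infty =>
      -- `pointSec ∞` is `1` on `ℂ` and `w` in the chart at `∞`, so `g` agrees with `f` on `ℂ`, and
      -- its value at `∞` is that of `F w / w` at `w = 0`.
      let F : ℂ → ℂ := fun w => if w = 0 then f OnePoint.infty else w ^ a * f ((w⁻¹ : ℂ) : OnePoint ℂ)
      refine ⟨fun p => p.elim (deriv F 0) fun z => f z, fun p => ?_, fun h => ⟨fun z hz => ?_, ?_⟩⟩
      · induction p using OnePoint.rec with
        | infty => simpa [pointSec] using hfx
        | coe z => simp [pointSec]
      · exact absurd hz.symm (OnePoint.coe_ne_infty z)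
      · refine fun _ => ((h.2 rfl).dslope_self : AnalyticAt ℂ (dslope F 0) 0).congr
          (Eventually.of_forall fun w => ?_)
        by_cases hw : w = 0
        · simp [hw, F]
        · simp only [hw, if_false, dslope_of_ne _ hw, slope, F, hfx, zpow_sub₀ hw]
          simp
          ring
    | coe b =>
      refine ⟨fun p => p.elim (f OnePoint.infty) (dslope (fun z : ℂ => f z) b), fun p => ?_,
        fun h => ⟨fun z hz => ?_, fun h => absurd h (OnePoint.coe_ne_infty b)⟩⟩
      · induction p using OnePoint.rec with
        | infty => simp [pointSec]
        | coe z =>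
          have := sub_smul_dslope (fun z : ℂ => f z) b z
          simpa [pointSec, hfx] using this.symm
      · obtain rfl : b = z := by simpa using hz
        exact (h.1 b rfl).dslope_self
  refine ⟨g, hg, fun p hp => ?_⟩
  by_cases hpx : p = x
  · subst hpx
    exact hx hp
  -- Away from `x` the section `pointSec x` is invertible and `g` is the quotient.
  · refine (sub_eq_add_neg a 1 ▸ hp.mul ((isHolAt_pointSec x p).inv
      fun h => hpx (pointSec_eq_zero_iff.1 h))).congr ?_
    filter_upwards [isOpen_ne.mem_nhds hpx] with q hq
    have h0 : pointSec x q ≠ 0 := fun h => hq (pointSec_eq_zero_iff.1 h)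
    simp [hg q]
    field_simp

theorem restrict_mem_secGroup {a : ℤ} {U : Opens P1} {f : OnePoint ℂ → ℂ}
    (hf : ∀ p ∈ U, IsHolAt a f p) : (fun p : U => f p.1) ∈ secGroup a U :=
  fun p hp => (hf p hp).congr (ext0_eventuallyEq _ _ (fun _ => rfl) hp)

theorem exists_eq_pointSec_mul_of_mem_secGroup {a : ℤ} {x : P1} {U : Opens P1} {f : U → ℂ}
    (hf : f ∈ secGroup a U) (hfx : ∀ hx : x ∈ U, f ⟨x, hx⟩ = 0) :
    ∃ g ∈ secGroup (a - 1) U, ∀ p : U, f p = pointSec x p.1 * g p := by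
  -- If `x ∉ U`, the extension by zero supplies the vanishing at `x`.
  have h0 : ext0 f x = 0 := by
    by_cases hx : x ∈ U
    · rw [ext0_apply f ⟨x, hx⟩, hfx hx]
    · exact Function.extend_apply' _ _ _ fun ⟨p, hp⟩ => hx (hp ▸ p.2)
  obtain ⟨g, hg, hol⟩ := exists_eq_pointSec_mul a h0
  exact ⟨fun p => g p.1, restrict_mem_secGroup fun p hp => hol p (hf p hp),
    fun p => by rw [← hg, ext0_apply]⟩

/-- Off `x` one can divide; at `x` the value is a limit of zeros. -/
theorem eq_zero_of_pointSec_mul_eq_zero {a : ℤ} {x : P1} {U : Opens P1} {f : U → ℂ}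
    (hf : f ∈ secGroup a U) (h : ∀ p : U, pointSec x p.1 * f p = 0) : f = 0 := by
  have h1 : ∀ p : U, p.1 ≠ x → f p = 0 := fun p hp =>
    (mul_eq_zero.1 (h p)).resolve_left fun h0 => hp (pointSec_eq_zero_iff.1 h0)
  funext p
  by_cases hp : p.1 = x
  · rw [← ext0_apply f p]
    refine (hf p.1 p.2).eq_zero_of_eventually ?_
    filter_upwards [nhdsWithin_le_nhds (U.isOpen.mem_nhds p.2), self_mem_nhdsWithin] with q hq hqp
    rw [ext0_apply f ⟨q, hq⟩]
    exact h1 _ fun h => hqp (h.trans hp.symm)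
  · exact h1 p hp

theorem isOpen_compl_point (q : P1) : IsOpen ({q}ᶜ : Set P1) := by
  have : T1Space P1 := inferInstanceAs (T1Space (OnePoint ℂ))
  exact isOpen_compl_singleton

/-- The open set `ℙ¹ \ {q}`. -/
def complPoint (q : P1) : Opens P1 := ⟨{q}ᶜ, isOpen_compl_point q⟩

theorem pointSec_ne_zero {q p : P1} (hp : p ∈ complPoint q) : pointSec q p ≠ 0 :=
  fun h => hp (pointSec_eq_zero_iff.1 h)

/-- Line bundles are trivial near every point. -/
theorem exists_unit_section (x : P1) : ∃ U : Opens P1, x ∈ U ∧ ∀ a : ℤ, ∃ t ∈ secGroup a U,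
    (∃ t' ∈ secGroup (-a) U, t' * t = 1) ∧ ∀ hx : x ∈ U, t ⟨x, hx⟩ = 1 := by
  obtain ⟨q, hq⟩ : ∃ q : OnePoint ℂ, q ≠ x := exists_ne x
  have h0 : ∀ p ∈ complPoint q, pointSec q p ≠ 0 := fun p hp => pointSec_ne_zero hp
  have hx : x ∈ complPoint q := fun h => hq h.symm
  have key : ∀ a : ℤ, ∀ p ∈ complPoint q, IsHolAt a (pointSec q ^ a) p := fun a p hp => by
    simpa using (isHolAt_pointSec q p).zpow (h0 p hp) a
  -- `pointSec q ^ a` trivialises `𝒪(a)` off `q`; the constant normalises its value at `x` to `1`.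
  refine ⟨complPoint q, hx, fun a =>
    ⟨_, restrict_mem_secGroup fun p hp => (key a p hp).const_smul (pointSec q x ^ a)⁻¹,
      ⟨_, restrict_mem_secGroup fun p hp => (key (-a) p hp).const_smul (pointSec q x ^ a), ?_⟩, ?_⟩⟩
  · funext p
    have := h0 p.1 p.2
    have := h0 x hx
    simp
    field_simp
  · intro hx
    have := h0 x hx
    simp
    field_simp

/-! ### Projections and inclusions of a biproduct, transported along an isomorphism -/

section Biproduct

variable {C : Type*} [Category* C] [Preadditive C] [HasFiniteBiproducts C] {n : ℕ} {f : Fin n → C}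
  {X : C} (φ : X ≅ ⨁ f)

theorem iso_biproduct_ι_π_self (j : Fin n) :
    (biproduct.ι f j ≫ φ.inv) ≫ φ.hom ≫ biproduct.π f j = 𝟙 _ := by
  simp

theorem iso_biproduct_ι_π_ne {j k : Fin n} (h : j ≠ k) :
    (biproduct.ι f j ≫ φ.inv) ≫ φ.hom ≫ biproduct.π f k = 0 := by
  simp [biproduct.ι_π_ne _ h]

theorem iso_biproduct_total :
    ∑ j, (φ.hom ≫ biproduct.π f j) ≫ biproduct.ι f j ≫ φ.inv = 𝟙 X := by
  have h : ∀ j, (φ.hom ≫ biproduct.π f j) ≫ biproduct.ι f j ≫ φ.inv =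
      φ.hom ≫ (biproduct.π f j ≫ biproduct.ι f j) ≫ φ.inv := fun j => by simp
  simp_rw [h, ← Preadditive.comp_sum, ← Preadditive.sum_comp, biproduct.total]
  simp

end Biproduct

/-! ### Coordinates of sections and germs; the fibre, the flag and the lattice in `ℂⁿ` -/

section Stalks

variable {E : OMod} {n : ℕ} {a : Fin n → ℤ}

/-- The value at `x` of a germ of a holomorphic function. -/
def evalO (x : P1) : StalkO x →+* ℂ :=
  CommRingCat.Hom.hom (R := presheafO.stalk x) (S := CommRingCat.of ℂ)
    (colimit.desc ((OpenNhds.inclusion x).op ⋙ presheafO) ⟨CommRingCat.of ℂ,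
      { app := fun U => CommRingCat.ofHom
          ((Pi.evalRingHom (fun _ => ℂ) (⟨x, U.unop.2⟩ : U.unop.1)).comp
            (secRing U.unop.1).subtype)
        naturality := fun _ _ _ => rfl }⟩)

theorem evalO_germ {x : P1} (U : Opens P1) (hx : x ∈ U) (f : secRing U) :
    evalO x (presheafO.germ U x hx f) = f.1 ⟨x, hx⟩ :=
  congrArg (fun g => CommRingCat.Hom.hom g f)
    (colimit.ι_desc (F := (OpenNhds.inclusion x).op ⋙ presheafO) _ (op ⟨U, hx⟩))

theorem evalO_algebraMap (x : P1) (c : ℂ) : evalO x (algebraMap ℂ (StalkO x) c) = c :=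
  evalO_germ ⊤ trivial (constHom ⊤ c)

theorem exists_germ_eq (E : OMod) {x : P1} (m : Stalk E x) :
    ∃ (U : Opens P1) (hx : x ∈ U) (e : E.val.obj (op U)), germ E U hx e = m :=
  TopCat.Presheaf.exists_germ_eq (C := Ab.{0}) (X := P1) E.val.presheaf m

theorem exists_germO_eq {x : P1} (r : StalkO x) :
    ∃ (U : Opens P1) (hx : x ∈ U) (f : secRing U), presheafO.germ U x hx f = r :=
  TopCat.Presheaf.exists_germ_eq presheafO r

theorem evalO_eq_zero_of_mem {x : P1} {r : StalkO x} (hr : r ∈ maxIdeal x) : evalO x r = 0 := by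
  have : maxIdeal x ≤ RingHom.ker (evalO x) := by
    refine Ideal.span_le.2 ?_
    rintro _ ⟨U, hx, f, hf, rfl⟩
    exact (evalO_germ U hx f).trans hf
  exact this hr

/-- The `j`-th coordinate of the sections of `ℰ ≃ ⨁ᵢ 𝒪(aᵢ)`. -/
def coordSec (φ : E ≅ splitBundle a) (j : Fin n) (U : Opens P1) :
    E.val.obj (op U) →+ secGroup (a j) U :=
  ((φ.hom ≫ biproduct.π (fun i => lineBundle (a i)) j).val.app (op U)).hom.toAddMonoidHom

/-- The inclusion of the sections of the `j`-th summand of `ℰ ≃ ⨁ᵢ 𝒪(aᵢ)`. -/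
def summandSec (φ : E ≅ splitBundle a) (j : Fin n) (U : Opens P1) :
    secGroup (a j) U →+ E.val.obj (op U) :=
  ((summand φ j).val.app (op U)).hom.toAddMonoidHom

variable (φ : E ≅ splitBundle a)

theorem coordSec_smul (j : Fin n) {U : Opens P1} (r : secRing U) (e : E.val.obj (op U)) :
    coordSec φ j U ((show ringSheafO.obj.obj (op U) from r) • e) = r • coordSec φ j U e :=
  ((φ.hom ≫ biproduct.π (fun i => lineBundle (a i)) j).val.app (op U)).hom.map_smul _ _

theorem summandSec_smul (j : Fin n) {U : Opens P1} (r : secRing U) (t : secGroup (a j) U) :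
    summandSec φ j U (r • t) = (show ringSheafO.obj.obj (op U) from r) • summandSec φ j U t :=
  ((summand φ j).val.app (op U)).hom.map_smul _ _

theorem coordSec_res (j : Fin n) {U V : Opens P1} (i : U ⟶ V) (e : E.val.obj (op V)) :
    coordSec φ j U (E.val.map i.op e) =
      ⟨fun p => (coordSec φ j V e).1 ⟨p.1, i.le p.2⟩, res_mem_secGroup i (coordSec φ j V e).2⟩ :=
  PresheafOfModules.naturality_apply
    (φ.hom ≫ biproduct.π (fun i => lineBundle (a i)) j).val i.op e

theorem coordSec_summandSec_self (j : Fin n) {U : Opens P1} (t : secGroup (a j) U) :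
    coordSec φ j U (summandSec φ j U t) = t := by
  have h : summand φ j ≫ φ.hom ≫ biproduct.π (fun i => lineBundle (a i)) j = 𝟙 _ :=
    iso_biproduct_ι_π_self φ j
  exact congrArg (fun g : lineBundle (a j) ⟶ lineBundle (a j) => (g.val.app (op U)).hom t) h

theorem coordSec_summandSec_of_ne {j k : Fin n} (hjk : j ≠ k) {U : Opens P1}
    (t : secGroup (a j) U) : coordSec φ k U (summandSec φ j U t) = 0 := by
  have h : summand φ j ≫ φ.hom ≫ biproduct.π (fun i => lineBundle (a i)) k = 0 :=
    iso_biproduct_ι_π_ne φ hjk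
  exact congrArg (fun g : lineBundle (a j) ⟶ lineBundle (a k) => (g.val.app (op U)).hom t) h

/-- The homomorphism induced on the sections over `U`. -/
def appHom {M N : OMod} (U : Opens P1) : (M ⟶ N) →+ (M.val.obj (op U) →+ N.val.obj (op U)) where
  toFun f := (f.val.app (op U)).hom.toAddMonoidHom
  map_zero' := rfl
  map_add' _ _ := rfl

theorem sum_summandSec_coordSec {U : Opens P1} (e : E.val.obj (op U)) :
    ∑ j, summandSec φ j U (coordSec φ j U e) = e := by
  have h : ∑ j, (φ.hom ≫ biproduct.π (fun i => lineBundle (a i)) j) ≫ summand φ j = 𝟙 E :=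
    iso_biproduct_total φ
  have h2 := DFunLike.congr_fun (congrArg (appHom U) h) e
  rw [map_sum, AddMonoidHom.finsetSum_apply] at h2
  exact h2

theorem ext_coordSec {U : Opens P1} {e e' : E.val.obj (op U)}
    (h : ∀ j, coordSec φ j U e = coordSec φ j U e') : e = e' := by
  rw [← sum_summandSec_coordSec φ e, ← sum_summandSec_coordSec φ e']
  simp [h]

/-- The section of `ℰ` with given coordinates. -/
def ofCoords {U : Opens P1} (t : ∀ j, secGroup (a j) U) : E.val.obj (op U) :=
  ∑ j, summandSec φ j U (t j)

theorem coordSec_ofCoords {U : Opens P1} (t : ∀ j, secGroup (a j) U) (k : Fin n) :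
    coordSec φ k U (ofCoords φ t) = t k := by
  rw [ofCoords, map_sum, Finset.sum_eq_single k
    (fun j _ hj => coordSec_summandSec_of_ne φ hj _) (by simp), coordSec_summandSec_self]

/-- The values at `x` of the coordinates of a germ. -/
def evalStalk (x : P1) : Stalk E x →+ (Fin n → ℂ) :=
  AddCommGrpCat.Hom.hom (X := TopCat.Presheaf.stalk (C := Ab.{0}) (X := P1) E.val.presheaf x)
    (Y := AddCommGrpCat.of (Fin n → ℂ))
    (colimit.desc ((OpenNhds.inclusion x).op ⋙ E.val.presheaf) ⟨AddCommGrpCat.of (Fin n → ℂ),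
      { app := fun U => AddCommGrpCat.ofHom
          (AddMonoidHom.mk' (fun e j => (coordSec φ j U.unop.1 e).1 ⟨x, U.unop.2⟩)
            (fun e e' => by
            funext j
            exact congrArg (fun f => f.1 ⟨x, U.unop.2⟩) (map_add (coordSec φ j U.unop.1) e e')))
        naturality := fun U V i => by
          ext e
          funext j
          exact congrFun (congrArg Subtype.val
            (coordSec_res φ j ((OpenNhds.inclusion x).map i.unop) e)) ⟨x, V.unop.2⟩ }⟩)

theorem evalStalk_germ {x : P1} (U : Opens P1) (hx : x ∈ U) (e : E.val.obj (op U)) :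
    evalStalk φ x (germ E U hx e) = fun j => (coordSec φ j U e).1 ⟨x, hx⟩ :=
  congrArg (fun g => AddCommGrpCat.Hom.hom g e)
    (colimit.ι_desc (F := (OpenNhds.inclusion x).op ⋙ E.val.presheaf) _ (op ⟨U, hx⟩))

theorem exists_germ_eq_germ_eq {x : P1} (r : StalkO x) (m : Stalk E x) :
    ∃ (U : Opens P1) (hx : x ∈ U) (f : secRing U) (e : E.val.obj (op U)),
      presheafO.germ U x hx f = r ∧ germ E U hx e = m := by
  obtain ⟨U, hU, f, rfl⟩ := exists_germO_eq r
  obtain ⟨V, hV, e, rfl⟩ := exists_germ_eq E m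
  exact ⟨U ⊓ V, ⟨hU, hV⟩, presheafO.map (homOfLE inf_le_left).op f,
    E.val.map (homOfLE inf_le_right).op e,
    TopCat.Presheaf.germ_res_apply presheafO (homOfLE inf_le_left) x ⟨hU, hV⟩ f,
    germ_res E (homOfLE inf_le_right) _ e⟩

theorem evalStalk_smul {x : P1} (r : StalkO x) (m : Stalk E x) :
    evalStalk φ x (r • m) = evalO x r • evalStalk φ x m := by
  obtain ⟨U, hx, f, e, rfl, rfl⟩ := exists_germ_eq_germ_eq r m
  refine (congrArg (evalStalk φ x) (germ_smul E U hx f e)).symm.trans ?_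
  rw [evalStalk_germ, evalStalk_germ, evalO_germ]
  funext j
  rw [coordSec_smul]
  rfl

/-- The values at `x` of the coordinates of a germ, as a `ℂ`-linear map. -/
def evalLin (x : P1) : Stalk E x →ₗ[ℂ] (Fin n → ℂ) where
  toFun := evalStalk φ x
  map_add' := map_add _
  map_smul' c m := (evalStalk_smul φ (algebraMap ℂ (StalkO x) c) m).trans
    (by rw [evalO_algebraMap]; rfl)

theorem evalLin_germ {x : P1} (U : Opens P1) (hx : x ∈ U) (e : E.val.obj (op U)) (j : Fin n) :
    evalLin φ x (germ E U hx e) j = (coordSec φ j U e).1 ⟨x, hx⟩ :=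
  congrFun (evalStalk_germ φ U hx e) j

theorem exists_unit_section_le {x : P1} {U : Opens P1} (hxU : x ∈ U) :
    ∃ V ≤ U, x ∈ V ∧ ∀ a : ℤ, ∃ t ∈ secGroup a V,
      (∃ t' ∈ secGroup (-a) V, t' * t = 1) ∧ ∀ hx : x ∈ V, t ⟨x, hx⟩ = 1 := by
  obtain ⟨U', hx, h⟩ := exists_unit_section x
  let i : U ⊓ U' ⟶ U' := homOfLE inf_le_right
  refine ⟨U ⊓ U', inf_le_left, ⟨hxU, hx⟩, fun a => ?_⟩
  obtain ⟨t, ht, ⟨t', ht', htt⟩, h1⟩ := h a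
  exact ⟨_, res_mem_secGroup i ht, ⟨_, res_mem_secGroup i ht',
    funext fun p => congrFun htt ⟨p.1, i.le p.2⟩⟩, fun _ => h1 hx⟩

/-- Near `x` each coordinate is `r • t` with `t` a unit section. If it vanishes at `x`, so does the
function `r`, whose germ then lies in `𝔪_x`. The converse holds because evaluation is semilinear
over `evalO`. -/
theorem evalLin_eq_zero_iff {x : P1} {m : Stalk E x} :
    evalLin φ x m = 0 ↔ m ∈ maxIdeal x • (⊤ : Submodule (StalkO x) (Stalk E x)) := by
  refine ⟨fun h => ?_, fun h => ?_⟩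
  · obtain ⟨U, hx, e, rfl⟩ := exists_germ_eq E m
    obtain ⟨V, hVU, hxV, ht⟩ := exists_unit_section_le hx
    obtain ⟨e', he'⟩ : ∃ e' : E.val.obj (op V), germ E V hxV e' = germ E U hx e :=
      ⟨E.val.map (homOfLE hVU).op e, germ_res E (homOfLE hVU) hxV e⟩
    rw [← he'] at h ⊢
    rw [← sum_summandSec_coordSec φ e', map_sum]
    refine Submodule.sum_mem _ fun j _ => ?_
    obtain ⟨t, htm, ⟨t', htm', htt⟩, -⟩ := ht (a j)
    let r : secRing V := ⟨(coordSec φ j V e').1 * t',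
      mul_mem_secGroup (add_neg_cancel _) (coordSec φ j V e').2 htm'⟩
    have hr : coordSec φ j V e' = r • (⟨t, htm⟩ : secGroup (a j) V) := by
      refine Subtype.ext ?_
      change _ = (coordSec φ j V e').1 * t' * t
      rw [mul_assoc, htt, mul_one]
    have h0 : (coordSec φ j V e').1 ⟨x, hxV⟩ = 0 := by
      rw [← evalLin_germ, h]
      rfl
    rw [hr, summandSec_smul]
    refine (germ_smul E V hxV r _).symm ▸ Submodule.smul_mem_smul
      (Ideal.subset_span ⟨V, hxV, r, ?_, rfl⟩) Submodule.mem_top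
    change (coordSec φ j V e').1 ⟨x, hxV⟩ * t' _ = 0
    rw [h0, zero_mul]
  · induction h using Submodule.smul_induction_on' with
    | smul r hr m _ =>
      refine (evalStalk_smul φ r m).trans ?_
      rw [evalO_eq_zero_of_mem hr, zero_smul]
    | add m _ m' _ h h' => rw [map_add, h, h', add_zero]

/-- A germ with given values of its coordinates at `x`, the coordinates being multiples of a unit
section. -/
theorem exists_germ_with_values (x : P1) (v : Fin n → ℂ) :
    ∃ (U : Opens P1) (hx : x ∈ U) (t : ∀ j, secGroup (a j) U), (∀ j, v j = 0 → t j = 0) ∧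
      evalLin φ x (germ E U hx (ofCoords φ t)) = v := by
  obtain ⟨U, hx, ht⟩ := exists_unit_section x
  choose t ht _ h1 using ht
  refine ⟨U, hx, fun j => constHom U (v j) • (⟨t (a j), ht (a j)⟩ : secGroup (a j) U),
    fun j hj => by simp only [hj, map_zero, zero_smul], funext fun j => ?_⟩
  rw [evalLin_germ, coordSec_ofCoords]
  change v j * t (a j) ⟨x, hx⟩ = v j
  rw [h1, mul_one]

theorem evalLin_surjective (x : P1) : Function.Surjective (evalLin φ x) := fun v =>
  let ⟨_, _, _, _, h⟩ := exists_germ_with_values φ x v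
  ⟨_, h⟩

/-- The identification of the fibre at `x` with `ℂⁿ`. -/
def fibreEquiv (x : P1) : Fibre E x ≃ₗ[ℂ] (Fin n → ℂ) :=
  (Submodule.Quotient.restrictScalarsEquiv ℂ
    (maxIdeal x • (⊤ : Submodule (StalkO x) (Stalk E x)))).symm ≪≫ₗ
  Submodule.quotEquivOfEq _ _ (by
    ext m
    rw [Submodule.restrictScalars_mem, LinearMap.mem_ker, evalLin_eq_zero_iff]) ≪≫ₗ
  (evalLin φ x).quotKerEquivOfSurjective (evalLin_surjective φ x)

theorem fibreEquiv_toFibre (x : P1) (m : Stalk E x) :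
    fibreEquiv φ x (toFibre E x m) = evalLin φ x m := rfl

theorem mem_map_subStalk_hn_iff {x : P1} {k : ℤ} (v : Fibre E x) :
    v ∈ (subStalk (hn φ k) x).map (toFibre E x) ↔
      ∀ j, a j < k → fibreEquiv φ x v j = 0 := by
  constructor
  · rintro ⟨m, hm, rfl⟩ j hj
    rw [fibreEquiv_toFibre]
    induction hm using Submodule.span_induction with
    | mem m hm =>
      obtain ⟨U, hx, e, he, rfl⟩ := hm
      have key : coordSec φ j U e = 0 := by
        have hle : (hn φ k).obj (op U) ≤ LinearMap.ker
            ((φ.hom ≫ biproduct.π (fun i => lineBundle (a i)) j).val.app (op U)).hom := by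
          refine iSup₂_le fun i hi => ?_
          rintro _ ⟨t, rfl⟩
          exact coordSec_summandSec_of_ne φ (fun h => by rw [h] at hi; omega) t
        exact hle he
      rw [evalLin_germ, key]
      rfl
    | zero => simp
    | add m m' _ _ h h' => rw [map_add, Pi.add_apply, h, h', add_zero]
    | smul r m _ h =>
      have := congrFun (evalStalk_smul φ r m) j
      refine this.trans ?_
      change evalO x r * evalLin φ x m j = 0
      rw [h, mul_zero]
  · intro hv
    obtain ⟨U, hx, t, ht, h⟩ := exists_germ_with_values φ x (fibreEquiv φ x v)
    refine ⟨germ E U hx (ofCoords φ t), Submodule.subset_span ⟨U, hx, _, ?_, rfl⟩,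
      (fibreEquiv φ x).injective h⟩
    refine Submodule.sum_mem _ fun j _ => ?_
    by_cases hj : k ≤ a j
    · exact Submodule.mem_iSup_of_mem j (Submodule.mem_iSup_of_mem hj ⟨t j, rfl⟩)
    -- The `j`-th coordinate must vanish as a section, not only at `x`.
    · rw [ht j (hv j (not_le.1 hj)), map_zero]
      exact Submodule.zero_mem _

/-- The subspace of `ℂⁿ` that corresponds to the image of `Λ` in the fibre. -/
def latticeSpace {x : P1} (Λ : Submodule (StalkO x) (Stalk E x)) : Submodule ℂ (Fin n → ℂ) :=
  (Λ.restrictScalars ℂ).map (evalLin φ x)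

/-- The kernel `𝔪_x ℰ_x` of evaluation lies in `Λ`, so `Λ` is the full preimage of its image. -/
theorem mem_lattice_iff {x : P1} {Λ : Submodule (StalkO x) (Stalk E x)}
    (hΛ : maxIdeal x • (⊤ : Submodule (StalkO x) (Stalk E x)) ≤ Λ) (m : Stalk E x) :
    m ∈ Λ ↔ evalLin φ x m ∈ latticeSpace φ Λ := by
  refine ⟨fun h => ⟨m, h, rfl⟩, ?_⟩
  rintro ⟨m', hm', h⟩
  have h0 : evalLin φ x (m - m') = 0 := by rw [map_sub, h, sub_self]
  simpa using Λ.add_mem (hΛ ((evalLin_eq_zero_iff φ).1 h0)) hm'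

theorem mem_map_toFibre_iff {x : P1} (Λ : Submodule (StalkO x) (Stalk E x)) (v : Fibre E x) :
    v ∈ Λ.map (toFibre E x) ↔ fibreEquiv φ x v ∈ latticeSpace φ Λ := by
  constructor
  · rintro ⟨m, hm, rfl⟩
    exact ⟨m, hm, rfl⟩
  · rintro ⟨m, hm, h⟩
    exact ⟨m, hm, (fibreEquiv φ x).injective h⟩

theorem finrank_eq_of_mem_iff {x : P1} {P : Submodule (StalkO x) (Fibre E x)}
    {Q : Submodule ℂ (Fin n → ℂ)} (h : ∀ v, v ∈ P ↔ fibreEquiv φ x v ∈ Q) :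
    Module.finrank ℂ P = Module.finrank ℂ Q := by
  refine LinearEquiv.finrank_eq (LinearEquiv.ofSubmodules (fibreEquiv φ x)
    (P.restrictScalars ℂ) Q ?_)
  ext w
  constructor
  · rintro ⟨v, hv, rfl⟩
    exact (h v).1 hv
  · intro hw
    exact ⟨(fibreEquiv φ x).symm w, (h _).2 (by simpa using hw), by simp⟩

/-- The vectors of `ℂⁿ` supported on the first `i` blocks. -/
def flagSpace {s : ℕ} {ι : Type*} (b : ι → Fin s) (i : ℕ) : Submodule ℂ (ι → ℂ) where
  carrier := {v | ∀ j, i ≤ (b j : ℕ) → v j = 0}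
  zero_mem' _ _ := rfl
  add_mem' hv hw j hj := by rw [Pi.add_apply, hv j hj, hw j hj, add_zero]
  smul_mem' c v hv j hj := by rw [Pi.smul_apply, hv j hj, smul_zero]

theorem flagDim_eq {s : ℕ} {α : Fin s → ℤ} (hα : StrictAnti α) {b : Fin n → Fin s}
    (hb : ∀ j, a j = α (b j)) {x : P1} (Λ : Submodule (StalkO x) (Stalk E x))
    (i : Fin (s + 1)) :
    flagDim φ α Λ i = Module.finrank ℂ ↥(flagSpace b i ⊓ latticeSpace φ Λ) := by
  refine finrank_eq_of_mem_iff φ fun v => ?_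
  rw [Submodule.mem_inf, Submodule.mem_inf, mem_map_toFibre_iff φ]
  refine and_congr_left fun _ => ?_
  induction i using Fin.cases with
  | zero =>
    change v ∈ (⊥ : Submodule _ _) ↔ ∀ j, 0 ≤ _ → _
    rw [Submodule.mem_bot, ← (fibreEquiv φ x).map_eq_zero_iff]
    simp only [funext_iff, Nat.zero_le, true_implies, Pi.zero_apply]
  | succ i =>
    refine (mem_map_subStalk_hn_iff φ v).trans (forall_congr' fun j => ?_)
    -- `α (b j) < α i` becomes `i < b j`, which is `i + 1 ≤ b j` by definition.
    rw [hb, hα.lt_iff_gt]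
    rfl

end Stalks

/-! ### Adapted bases and a dimension count -/

section LinearAlgebra

variable {K : Type*} [Field K]

/-- Every subspace of `Kⁿ` of dimension `m` is spanned by the first `m` vectors of a basis. -/
theorem exists_basis_adapted {n : ℕ} (W : Submodule K (Fin n → K)) :
    ∃ u : Module.Basis (Fin n) K (Fin n → K),
      (∀ j : Fin n, (j : ℕ) < Module.finrank K W → u j ∈ W) ∧
      ∀ w ∈ W, ∀ j : Fin n, Module.finrank K W ≤ j → u.repr w j = 0 := by
  obtain ⟨C, hC⟩ := W.exists_isCompl
  have hn : Module.finrank K W + Module.finrank K C = n := by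
    rw [Submodule.finrank_add_eq_of_isCompl hC, Module.finrank_fin_fun]
  let B := (((Module.finBasis K W).prod (Module.finBasis K C)).map
    (Submodule.prodEquivOfIsCompl W C hC))
  let r : Fin (Module.finrank K W) ⊕ Fin (Module.finrank K C) ≃ Fin n :=
    finSumFinEquiv.trans (finCongr hn)
  refine ⟨B.reindex r, fun j hj => ?_, fun w hw j hj => ?_⟩
  · obtain ⟨l, rfl⟩ := r.surjective j
    rcases l with l | l
    · simp [B]
    · simp [r] at hj
  · obtain ⟨l, rfl⟩ := r.surjective j
    rcases l with l | l
    · simp only [r, Equiv.trans_apply, finSumFinEquiv_apply_left, finCongr_apply, Fin.val_cast,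
        Fin.val_castAdd] at hj
      omega
    · have : (Submodule.prodEquivOfIsCompl W C hC).symm w = (⟨w, hw⟩, 0) := by
        rw [LinearEquiv.symm_apply_eq]
        simp
      simp [B, this]

/-- Rank-nullity for the restriction of `f` to `P`, whose kernel is `Q`. -/
theorem finrank_map_add_finrank {V V' : Type*} [AddCommGroup V] [Module K V] [AddCommGroup V']
    [Module K V'] [FiniteDimensional K V] (f : V →ₗ[K] V') {P Q : Submodule K V} (hQP : Q ≤ P)
    (hQ : ∀ v ∈ P, f v = 0 ↔ v ∈ Q) :
    Module.finrank K (P.map f) + Module.finrank K Q = Module.finrank K P := by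
  have hker : Q.comap P.subtype = LinearMap.ker (f.domRestrict P) := by
    ext v
    simpa using (hQ v.1 v.2).symm
  rw [← (f.domRestrict P).finrank_range_add_finrank_ker, LinearMap.range_domRestrict,
    ← (Submodule.comapSubtypeEquivOfLe hQP).finrank_eq, hker]

end LinearAlgebra

/-! ### A basis of `ℂⁿ` adapted to the block flag and to a subspace -/

section Flag

variable {s : ℕ} {ν : Fin s → ℕ} {ι : Type*} (e : ι ≃ Σ i, Fin (ν i))
  (W : Submodule ℂ (ι → ℂ))

theorem flagSpace_mono (b : ι → Fin s) {i k : ℕ} (h : i ≤ k) : flagSpace b i ≤ flagSpace b k :=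
  fun _ hv j hj => hv j (h.trans hj)

/-- The dimension of the intersection of `W` with the first `i` blocks. -/
def blockDim (i : ℕ) : ℕ := Module.finrank ℂ ↥(flagSpace (fun j => (e j).1) i ⊓ W)

/-- The coordinates in the `i`-th block. -/
def blockProj (i : Fin s) : (ι → ℂ) →ₗ[ℂ] (Fin (ν i) → ℂ) :=
  LinearMap.funLeft ℂ ℂ fun l => e.symm ⟨i, l⟩

theorem blockProj_eq_zero_iff {i : Fin s} {v : ι → ℂ}
    (hv : v ∈ flagSpace (fun j => (e j).1) (i + 1)) :
    blockProj e i v = 0 ↔ v ∈ flagSpace (fun j => (e j).1) i := by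
  constructor
  · intro h j hj
    rcases hj.eq_or_lt with hj | hj
    · obtain ⟨⟨k, l⟩, rfl⟩ := e.symm.surjective j
      obtain rfl : i = k := Fin.ext (by simpa using hj)
      exact congrFun h l
    · exact hv j hj
  · intro h
    funext l
    exact h _ (by simp)

variable [Fintype ι]

/-- The block projection kills exactly the previous step of the flag, so its image of `W` is the
graded piece of `W`, whose dimension is the multiplicity `mᵢ`. -/
theorem finrank_map_blockProj (i : Fin s) :
    Module.finrank ℂ ((flagSpace (fun j => (e j).1) (i + 1) ⊓ W).map (blockProj e i)) +
      blockDim e W i = blockDim e W (i + 1) := by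
  refine finrank_map_add_finrank _ (inf_le_inf_right _ (flagSpace_mono _ (Nat.le_succ _))) ?_
  rintro v ⟨h1, h2⟩
  rw [blockProj_eq_zero_iff e h1]
  exact ⟨fun h => ⟨h, h2⟩, fun h => h.1⟩

theorem blockDim_mono (i : Fin s) : blockDim e W i ≤ blockDim e W (i + 1) :=
  (finrank_map_blockProj e W i) ▸ Nat.le_add_left _ _

theorem finrank_map_blockProj_eq (i : Fin s) :
    Module.finrank ℂ ((flagSpace (fun j => (e j).1) (i + 1) ⊓ W).map (blockProj e i)) =
      blockDim e W (i + 1) - blockDim e W i :=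
  Nat.eq_sub_of_add_eq (finrank_map_blockProj e W i)

theorem blockDim_sub_le (i : Fin s) : blockDim e W (i + 1) - blockDim e W i ≤ ν i := by
  rw [← finrank_map_blockProj_eq]
  exact (Submodule.finrank_le _).trans (Module.finrank_fin_fun ℂ).le

/-- Take a basis of the `i`-th block that begins with a basis of the graded piece of `W`. Vectors of
the graded piece lift into `W` by definition; the others are extended by zero. -/
theorem exists_lift_adapted (i : Fin s) :
    ∃ (u : Module.Basis (Fin (ν i)) ℂ (Fin (ν i) → ℂ)) (v : Fin (ν i) → ι → ℂ),
      (∀ l, v l ∈ flagSpace (fun j => (e j).1) (i + 1)) ∧ (∀ l, blockProj e i (v l) = u l) ∧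
      (∀ l : Fin (ν i), (l : ℕ) < blockDim e W (i + 1) - blockDim e W i → v l ∈ W) ∧
      ∀ w ∈ W, w ∈ flagSpace (fun j => (e j).1) (i + 1) →
        ∀ l : Fin (ν i), blockDim e W (i + 1) - blockDim e W i ≤ l →
          u.repr (blockProj e i w) l = 0 := by
  obtain ⟨u, hu, hu'⟩ := exists_basis_adapted
    ((flagSpace (fun j => (e j).1) (i + 1) ⊓ W).map (blockProj e i))
  rw [finrank_map_blockProj_eq] at hu hu'
  have : ∀ l : Fin (ν i), ∃ v ∈ flagSpace (fun j => (e j).1) (i + 1), blockProj e i v = u l ∧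
      ((l : ℕ) < blockDim e W (i + 1) - blockDim e W i → v ∈ W) := by
    intro l
    by_cases hl : (l : ℕ) < blockDim e W (i + 1) - blockDim e W i
    · obtain ⟨v, hv, h⟩ := hu l hl
      exact ⟨v, hv.1, h, fun _ => hv.2⟩
    · have hinj : Function.Injective fun l : Fin (ν i) => e.symm ⟨i, l⟩ := fun l l' h => by
        simpa using h
      refine ⟨Function.extend (fun l => e.symm ⟨i, l⟩) (u l) 0, fun j hj => ?_, ?_,
        fun h => absurd h hl⟩
      · refine Function.extend_apply' _ _ _ ?_
        rintro ⟨l', rfl⟩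
        simp at hj
      · funext l'
        exact hinj.extend_apply _ _ _
  choose v h1 h2 h3 using this
  exact ⟨u, v, h1, h2, h3, fun w hw hwf l hl => hu' _ ⟨w, ⟨hwf, hw⟩, rfl⟩ l hl⟩

variable [DecidableEq ι]

/-- A subspace of `ℂⁿ` is moved to a coordinate subspace by a block triangular matrix. -/
theorem exists_blockTriangular_adapted :
    ∃ c : Matrix ι ι ℂ, IsUnit c ∧ c.BlockTriangular (fun j => (e j).1) ∧
      (∀ j, ((e j).2 : ℕ) < blockDim e W ((e j).1 + 1) - blockDim e W (e j).1 →
        (fun k => c k j) ∈ W) ∧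
      ∀ t, c.mulVec t ∈ W →
        ∀ j, blockDim e W ((e j).1 + 1) - blockDim e W (e j).1 ≤ (e j).2 → t j = 0 := by
  choose u v hv huv hvW hW using exists_lift_adapted e W
  -- The columns of the matrix: the lifted basis vectors of all blocks.
  let V : ι → ι → ℂ := fun j => v (e j).1 (e j).2
  have hV : ∀ i l, V (e.symm ⟨i, l⟩) = v i l := fun i l => by
    simp only [V]
    rw [e.apply_symm_apply]
  have hVsum : ∀ t : ι → ℂ, (Matrix.of fun k j => V j k).mulVec t = ∑ j, t j • V j := fun t => by
    funext k
    simp [Matrix.mulVec, dotProduct, mul_comm]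
  -- Vectors of earlier blocks vanish on block `i`, so once later blocks are discarded, projecting
  -- to block `i` reads off the coefficients of that block.
  have hrepr : ∀ (t : ι → ℂ) (i : Fin s) (l : Fin (ν i)),
      (u i).repr (blockProj e i (∑ j with (e j).1 ≤ i, t j • V j)) l = t (e.symm ⟨i, l⟩) := by
    intro t i l
    have h1 : blockProj e i (∑ j with (e j).1 ≤ i, t j • V j) =
        ∑ l, t (e.symm ⟨i, l⟩) • u i l := by
      rw [map_sum, Finset.sum_filter, ← e.symm.sum_comp, Fintype.sum_sigma,
        Finset.sum_eq_single i]
      · refine Finset.sum_congr rfl fun l _ => ?_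
        simp [hV, huv]
      · intro k _ hk
        refine Finset.sum_eq_zero fun l _ => ?_
        rw [hV, e.apply_symm_apply]
        split_ifs with hki
        · have hlt : (k : ℕ) + 1 ≤ i := lt_of_le_of_ne hki hk
          rw [map_smul, (blockProj_eq_zero_iff e (flagSpace_mono _ (by omega) (hv k l))).2
            (flagSpace_mono _ hlt (hv k l)), smul_zero]
        · rfl
      · simp
    rw [h1, (u i).repr_sum_self]
  have hflag : ∀ (t : ι → ℂ) (i : Fin s),
      ∑ j with (e j).1 ≤ i, t j • V j ∈ flagSpace (fun j => (e j).1) (i + 1) := fun t i => by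
    refine Submodule.sum_mem _ fun j hj => Submodule.smul_mem _ _
      (flagSpace_mono _ ?_ (hv (e j).1 (e j).2))
    exact Nat.succ_le_succ (Finset.mem_filter.1 hj).2
  have hsplit : ∀ (t : ι → ℂ) (i : Fin s), ∑ j with (e j).1 ≤ i, t j • V j =
      ∑ j, t j • V j - ∑ j with ¬ (e j).1 ≤ i, t j • V j := fun t i =>
    eq_sub_of_add_eq (Finset.sum_filter_add_sum_filter_not _ _ _)
  -- Descending induction on the block: the last coefficients are determined first.
  have hind : ∀ p : ι → Prop, (∀ i, (∀ j, i < (e j).1 → p j) → ∀ l, p (e.symm ⟨i, l⟩)) →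
      ∀ j, p j := by
    intro p hp
    have : ∀ i, ∀ l, p (e.symm ⟨i, l⟩) := by
      intro i
      induction i using WellFoundedGT.induction with
      | ind i ih =>
        refine hp i fun j hj => ?_
        simpa using ih _ hj (e j).2
    exact fun j => by simpa using this (e j).1 (e j).2
  refine ⟨Matrix.of fun k j => V j k, ?_, ?_, ?_, ?_⟩
  · rw [← Matrix.mulVec_injective_iff_isUnit]
    refine (injective_iff_map_eq_zero (Matrix.mulVecLin _)).2 fun t ht => ?_
    rw [Matrix.mulVecLin_apply, hVsum] at ht
    refine funext (hind (fun j => t j = 0) fun i ih l => ?_)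
    refine (hrepr t i l).symm.trans ?_
    rw [hsplit, ht, Finset.sum_eq_zero, sub_zero, map_zero, map_zero]
    · rfl
    · intro j hj
      rw [ih j (not_le.1 (Finset.mem_filter.1 hj).2), zero_smul]
  · exact fun k j hkj => hv (e j).1 (e j).2 k hkj
  · exact fun j hj => hvW _ _ hj
  · intro t ht
    rw [hVsum] at ht
    refine hind _ fun i ih l hl => ?_
    refine (hrepr t i l).symm.trans ?_
    replace hl : blockDim e W ((e (e.symm ⟨i, l⟩)).1 + 1) - blockDim e W (e (e.symm ⟨i, l⟩)).1 ≤
        ((e (e.symm ⟨i, l⟩)).2 : ℕ) := hl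
    rw [e.apply_symm_apply] at hl
    refine hW i _ ?_ (hflag t i) l hl
    rw [hsplit]
    -- The terms of later blocks lie in `W`: each has its vector in `W` or, by induction, a zero
    -- coefficient. Hence the truncated sum lies in `W` and in the flag step, where the adapted
    -- basis applies.
    refine W.sub_mem ht (W.sum_mem fun j hj => ?_)
    by_cases hjm : ((e j).2 : ℕ) < blockDim e W ((e j).1 + 1) - blockDim e W (e j).1
    · exact W.smul_mem _ (hvW _ _ hjm)
    · rw [ih j (not_le.1 (Finset.mem_filter.1 hj).2) (not_lt.1 hjm), zero_smul]
      exact W.zero_mem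

end Flag

/-! ### Morphisms of sheaves of modules from their action on sections -/

section Morphisms

/-- A morphism of sheaves of modules, given on sections. -/
def homMk {M N : OMod} (f : ∀ U : Opens P1, M.val.obj (op U) →+ N.val.obj (op U))
    (hsmul : ∀ (U : Opens P1) (r : ringSheafO.obj.obj (op U)) (m : M.val.obj (op U)),
      f U (r • m) = r • f U m)
    (hres : ∀ {U V : Opens P1} (i : U ⟶ V) (m : M.val.obj (op V)),
      f U (M.val.map i.op m) = N.val.map i.op (f V m)) : M ⟶ N where
  val :=
    { app := fun U => ModuleCat.ofHom
        { toFun := f U.unop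
          map_add' := map_add _
          map_smul' := hsmul U.unop }
      naturality := fun i => by
        ext m
        exact hres i.unop m }

theorem isIso_of_bijective {M N : OMod} (f : M ⟶ N)
    (h : ∀ U : Opens P1, Function.Bijective (appHom U f)) : IsIso f := by
  let g : M.val ≅ N.val := PresheafOfModules.isoMk
    (fun U => (LinearEquiv.ofBijective (f.val.app U).hom (h U.unop)).toModuleIso)
    (fun _ _ i => f.val.naturality i)
  exact ⟨⟨g.inv⟩, SheafOfModules.hom_ext g.hom_inv_id, SheafOfModules.hom_ext g.inv_hom_id⟩

end Morphisms

/-! ### Twisted automorphisms and the splitting of the modified bundle -/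

section Modification

variable {E : OMod} {n : ℕ} {a : Fin n → ℤ} (φ : E ≅ splitBundle a)

theorem ofCoords_add {U : Opens P1} (t t' : ∀ j, secGroup (a j) U) :
    ofCoords φ (fun j => t j + t' j) = ofCoords φ t + ofCoords φ t' := by
  simp [ofCoords, Finset.sum_add_distrib]

theorem ofCoords_smul {U : Opens P1} (r : secRing U) (t : ∀ j, secGroup (a j) U) :
    ofCoords φ (fun j => r • t j) =
      (show ringSheafO.obj.obj (op U) from r) • ofCoords φ t :=
  (Finset.sum_congr rfl fun j _ => summandSec_smul φ j r (t j)).trans Finset.smul_sum.symm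

theorem ofCoords_res {U V : Opens P1} (i : U ⟶ V) (t : ∀ j, secGroup (a j) V) :
    (E.val.map i.op (ofCoords φ t) : E.val.obj (op U)) = ofCoords φ fun j =>
      (⟨fun p => (t j).1 ⟨p.1, i.le p.2⟩, res_mem_secGroup i (t j).2⟩ : secGroup (a j) U) := by
  have h : ∀ e t', (∀ j, coordSec φ j U e = t' j) → e = ofCoords φ t' := fun e t' h =>
    ext_coordSec φ fun j => (h j).trans (coordSec_ofCoords φ t' j).symm
  exact h _ _ fun j => by rw [coordSec_res, coordSec_ofCoords]

/-- Multiplication by a global section of `𝒪(d)`. -/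
def mulGlobal {d b c : ℤ} (h : d + b = c) {g : OnePoint ℂ → ℂ} (hg : ∀ p, IsHolAt d g p)
    (U : Opens P1) : secGroup b U →+ secGroup c U :=
  AddMonoidHom.mk' (fun t => ⟨(fun p : U => g p.1) * t.1,
      mul_mem_secGroup h (restrict_mem_secGroup fun p _ => hg p) t.2⟩)
    (fun t t' => Subtype.ext (mul_add _ t.1 t'.1))

/-- The morphism `𝒪(b) → ℰ^Λ` with given coordinates `gₖ ∈ Γ(ℙ¹, 𝒪(aₖ - b))`. -/
def homModify {b : ℤ} {g : Fin n → OnePoint ℂ → ℂ} (hg : ∀ k p, IsHolAt (a k - b) (g k) p)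
    {x : P1} {Λ : Submodule (StalkO x) (Stalk E x)}
    (h : ∀ (U : Opens P1) (hx : x ∈ U) (t : secGroup b U), germ E U hx
      (ofCoords φ fun k => mulGlobal (sub_add_cancel (a k) b) (hg k) U t) ∈ Λ) :
    lineBundle b ⟶ modify E x Λ :=
  homMk
    (fun U => AddMonoidHom.mk'
      (fun t : secGroup b U =>
        (⟨ofCoords φ fun k => mulGlobal (sub_add_cancel _ _) (hg k) U t, fun hx => h U hx t⟩ :
          (modifySub E x Λ).obj (op U)))
      (fun t t' => Subtype.ext ((congrArg (ofCoords φ)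
        (funext fun k => map_add (mulGlobal (sub_add_cancel (a k) b) (hg k) U) t t')).trans
        (ofCoords_add φ _ _))))
    (fun _ r _ => Subtype.ext ((congrArg (ofCoords φ) (funext fun _ =>
      Subtype.ext (mul_left_comm _ _ _))).trans (ofCoords_smul φ r _)))
    (fun {_ V} i t => Subtype.ext
      (ofCoords_res φ i fun k => mulGlobal (sub_add_cancel (a k) b) (hg k) V t).symm)

section Twist

variable (a) in
/-- The entries of the endomorphism of `⨁ᵢ 𝒪(aᵢ)` obtained from a triangular matrix `c` and a
section `σ` of `𝒪(1)`. -/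
def twist (c : Matrix (Fin n) (Fin n) ℂ) (σ : OnePoint ℂ → ℂ) (k j : Fin n) (p : OnePoint ℂ) : ℂ :=
  c k j * σ p ^ (a k - a j).toNat

/-- `toNat` truncates only where the entry of `c` is zero. -/
theorem isHolAt_twist {c : Matrix (Fin n) (Fin n) ℂ} {σ : OnePoint ℂ → ℂ} {k j : Fin n}
    (hc : c k j ≠ 0 → a j ≤ a k) {p : OnePoint ℂ} (hσ : IsHolAt 1 σ p) :
    IsHolAt (a k - a j) (twist a c σ k j) p := by
  by_cases h : c k j = 0
  · have : twist a c σ k j = 0 := funext fun p => by simp [twist, h]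
    rw [this]
    exact isHolAt_zero _ _
  · have := (hσ.pow (a k - a j).toNat).const_smul (c k j)
    rwa [mul_one, Int.toNat_of_nonneg (sub_nonneg.2 (hc h))] at this

/-- In every nonzero term the exponents `a k - a j` and `a j - a l` are nonnegative and add up to `a
k - a l`, independent of `j`; a power of `σ` factors out of the matrix product. -/
theorem sum_twist_mul_twist {c c' : Matrix (Fin n) (Fin n) ℂ}
    (hc : ∀ k j, c k j ≠ 0 → a j ≤ a k) (hc' : ∀ k j, c' k j ≠ 0 → a j ≤ a k)
    (h : c * c' = 1) (σ : OnePoint ℂ → ℂ) (k l : Fin n) (p : OnePoint ℂ) :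
    ∑ j, twist a c σ k j p * twist a c' σ j l p = if k = l then 1 else 0 := by
  have h1 : ∀ j, twist a c σ k j p * twist a c' σ j l p =
      c k j * c' j l * σ p ^ (a k - a l).toNat := fun j => by
    by_cases h0 : c k j = 0
    · simp [twist, h0]
    by_cases h0' : c' j l = 0
    · simp [twist, h0']
    have : (a k - a l).toNat = (a k - a j).toNat + (a j - a l).toNat := by
      have := hc k j h0
      have := hc' j l h0'
      omega
    rw [this, pow_add, twist, twist]
    ring
  simp_rw [h1, ← Finset.sum_mul, ← Matrix.mul_apply, h, Matrix.one_apply]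
  split_ifs with hkl <;> simp [hkl]

end Twist

theorem exists_section_eq_one (x : P1) :
    ∃ σ : OnePoint ℂ → ℂ, (∀ p, IsHolAt 1 σ p) ∧ σ x = 1 := by
  obtain ⟨q, hq⟩ : ∃ q : OnePoint ℂ, q ≠ x := exists_ne x
  exact ⟨_, fun p => (isHolAt_pointSec q p).const_smul (pointSec q x)⁻¹,
    inv_mul_cancel₀ fun h => hq (pointSec_eq_zero_iff.1 h).symm⟩

/-- The isomorphism is the twist of `c` after the diagonal map `ε`. Its image lies in `ℰ^Λ` because
at `x` the columns outside `J` are killed by `ε`. It is injective because the twist is invertible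
and each `ε j` is a nonzerodivisor on sections. -/
theorem nonempty_iso_splitBundle {x : P1} {Λ : Submodule (StalkO x) (Stalk E x)}
    (hΛ : maxIdeal x • (⊤ : Submodule (StalkO x) (Stalk E x)) ≤ Λ)
    {c c' : Matrix (Fin n) (Fin n) ℂ} (hcc' : c * c' = 1)
    (hc : ∀ k j, c k j ≠ 0 → a j ≤ a k) (hc' : ∀ k j, c' k j ≠ 0 → a j ≤ a k)
    (J : Fin n → Prop) (hJ : ∀ j, J j → (fun k => c k j) ∈ latticeSpace φ Λ)
    (hJ' : ∀ t, c.mulVec t ∈ latticeSpace φ Λ → ∀ j, ¬ J j → t j = 0)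
    {b : Fin n → ℤ} (hb : ∀ j, J j → b j = a j) (hb' : ∀ j, ¬ J j → b j = a j - 1) :
    Nonempty (modify E x Λ ≅ splitBundle b) := by
  classical
  obtain ⟨σ, hσ, hσx⟩ := exists_section_eq_one x
  have hc'c : c' * c = 1 := mul_eq_one_comm.1 hcc'
  let ε : Fin n → OnePoint ℂ → ℂ := fun j => if J j then fun _ => 1 else pointSec x
  have hε : ∀ j p, IsHolAt (a j - b j) (ε j) p := fun j p => by
    by_cases h : J j
    · simpa [ε, hb j h, h] using isHolAt_const 1 p
    · simpa [ε, hb' j h, h] using isHolAt_pointSec x p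
  have hM : ∀ j k p, IsHolAt (a k - b j) (twist a c σ k j * ε j) p := fun j k p => by
    have := (isHolAt_twist (hc k j) (hσ p)).mul (hε j p)
    rwa [sub_add_sub_cancel] at this
  have htw : ∀ (c : Matrix (Fin n) (Fin n) ℂ) k j, twist a c σ k j x = c k j := fun c k j => by
    simp [twist, hσx]
  let ψ : ∀ j, lineBundle (b j) ⟶ modify E x Λ := fun j => homModify φ (hM j) (by
    intro U hx t
    rw [mem_lattice_iff φ hΛ]
    have h1 : evalLin φ x (germ E U hx (ofCoords φ fun k =>
        mulGlobal (sub_add_cancel _ _) (hM j k) U t)) =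
        (ε j x * t.1 ⟨x, hx⟩) • fun k => c k j := by
      funext k
      rw [evalLin_germ, coordSec_ofCoords]
      change twist a c σ k j x * ε j x * t.1 ⟨x, hx⟩ = _
      rw [htw, Pi.smul_apply, smul_eq_mul]
      ring
    rw [h1]
    by_cases h : J j
    · exact Submodule.smul_mem _ _ (hJ j h)
    · have : ε j x = 0 := by simp [ε, h, pointSec_eq_zero_iff]
      rw [this, zero_mul, zero_smul]
      exact Submodule.zero_mem _)
  let Ψ : splitBundle b ⟶ modify E x Λ := biproduct.desc ψ
  -- The identity splitting makes the coordinate maps available on the source.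
  let χ : splitBundle b ≅ splitBundle b := Iso.refl _
  have hΨ : ∀ (U : Opens P1) (T : (splitBundle b).val.obj (op U)) (k : Fin n) (p : U),
      (coordSec φ k U (appHom U Ψ T : (modifySub E x Λ).obj (op U)).1).1 p =
        ∑ j, twist a c σ k j p.1 * (ε j p.1 * (coordSec χ j U T).1 p) := by
    intro U T k p
    let A : (splitBundle b).val.obj (op U) →+ secGroup (a k) U :=
      (coordSec φ k U).comp (((modifySub E x Λ).obj (op U)).subtype.toAddMonoidHom.comp
        (appHom U Ψ))
    have hA : ∀ j (t : secGroup (b j) U),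
        A (summandSec χ j U t) = mulGlobal (sub_add_cancel _ _) (hM j k) U t := fun j t => by
      have h : summand χ j ≫ Ψ = ψ j :=
        (congrArg (· ≫ Ψ) (Category.comp_id _)).trans (biproduct.ι_desc ψ j)
      have h2 : appHom U Ψ (summandSec χ j U t) = appHom U (ψ j) t :=
        congrArg (fun g => appHom U g t) h
      change coordSec φ k U (appHom U Ψ (summandSec χ j U t) : (modifySub E x Λ).obj (op U)).1 = _
      rw [h2]
      exact coordSec_ofCoords φ _ k
    change (A T).1 p = _
    rw [← sum_summandSec_coordSec χ T, map_sum, AddSubgroup.val_finsetSum, Finset.sum_apply,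
      sum_summandSec_coordSec]
    refine Finset.sum_congr rfl fun j _ => ?_
    rw [hA]
    exact mul_assoc _ _ _
  have hinv : ∀ {c c' : Matrix (Fin n) (Fin n) ℂ}, (∀ k j, c k j ≠ 0 → a j ≤ a k) →
      (∀ k j, c' k j ≠ 0 → a j ≤ a k) → c * c' = 1 → ∀ (p : OnePoint ℂ) (y : Fin n → ℂ) (k : Fin n),
      ∑ j, twist a c σ k j p * ∑ l, twist a c' σ j l p * y l = y k := fun hc hc' h p y k => by
    simp_rw [Finset.mul_sum, ← mul_assoc]
    rw [Finset.sum_comm]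
    simp_rw [← Finset.sum_mul, sum_twist_mul_twist hc hc' h]
    simp
  have : IsIso Ψ := by
    refine isIso_of_bijective Ψ fun U => ⟨(injective_iff_map_eq_zero _).2 fun T hT => ?_,
      fun e => ?_⟩
    · refine ext_coordSec χ fun l => ?_
      rw [map_zero]
      have h0 : ∀ p : U, ε l p.1 * (coordSec χ l U T).1 p = 0 := fun p => by
        rw [← hinv hc' hc hc'c p.1 (fun j => ε j p.1 * (coordSec χ j U T).1 p) l]
        refine Finset.sum_eq_zero fun k _ => ?_
        rw [← hΨ, hT]
        change _ * (coordSec φ k U 0).1 p = 0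
        rw [map_zero]
        exact mul_zero _
      refine Subtype.ext ?_
      by_cases h : J l
      · funext p
        simpa [ε, h] using h0 p
      · exact eq_zero_of_pointSec_mul_eq_zero (coordSec χ l U T).2 fun p => by
          simpa [ε, h] using h0 p
    · obtain ⟨e, rfl⟩ : ∃ e' : (modifySub E x Λ).obj (op U), e' = e := ⟨e, rfl⟩
      let f : ∀ k, secGroup (a k) U := fun k => coordSec φ k U e.1
      -- Surjectivity: apply the inverse twist to the coordinates, then divide by `ε`.
      let y : ∀ l, secGroup (a l) U := fun l =>
        ∑ k, mulGlobal (sub_add_cancel _ _) (fun p => isHolAt_twist (hc' l k) (hσ p)) U (f k)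
      have hy : ∀ l p, (y l).1 p = ∑ k, twist a c' σ l k p.1 * (f k).1 p := fun l p => by
        simp only [y, AddSubgroup.val_finsetSum, Finset.sum_apply]
        rfl
      have hfy : ∀ k p, ∑ j, twist a c σ k j p.1 * (y j).1 p = (f k).1 p := fun k p => by
        simp_rw [hy]
        exact hinv hc hc' hcc' p.1 (fun l => (f l).1 p) k
      -- At `x` the twist is `c` itself, so `c` sends the values of `y` to a vector of `W`; they
      -- vanish outside `J`, which permits division by `pointSec x`.
      have hyx : ∀ l, ¬ J l → ∀ hx : x ∈ U, (y l).1 ⟨x, hx⟩ = 0 := fun l hl hx => by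
        refine hJ' (fun l => (y l).1 ⟨x, hx⟩) ?_ l hl
        have h1 := (mem_lattice_iff φ hΛ _).1 (e.2 hx)
        convert h1 using 1
        funext k
        rw [evalLin_germ]
        refine Eq.trans ?_ (hfy k ⟨x, hx⟩)
        simp [Matrix.mulVec, dotProduct, htw]
      have ht : ∀ l, ∃ t : secGroup (b l) U, ∀ p, (y l).1 p = ε l p.1 * t.1 p := fun l => by
        by_cases h : J l
        · refine ⟨⟨(y l).1, by simp [hb l h]⟩, fun p => by simp [ε, h]⟩
        · obtain ⟨g, hg, hyg⟩ := exists_eq_pointSec_mul_of_mem_secGroup (y l).2 (hyx l h)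
          exact ⟨⟨g, by simpa [hb' l h] using hg⟩, fun p => by simpa [ε, h] using hyg p⟩
      choose t ht using ht
      refine ⟨ofCoords χ t, Subtype.ext (ext_coordSec φ fun k => Subtype.ext (funext fun p => ?_))⟩
      refine (hΨ U _ k p).trans (Eq.trans ?_ (hfy k p))
      refine Finset.sum_congr rfl fun j _ => ?_
      rw [coordSec_ofCoords, ht]
  exact ⟨(asIso Ψ).symm⟩

end Modification

/-! ### Monotonicity of block sequences -/

theorem lex_of_finSigmaFinEquiv_le {s : ℕ} {ν : Fin s → ℕ} {p q : Σ i, Fin (ν i)}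
    (h : finSigmaFinEquiv p ≤ finSigmaFinEquiv q) : p.1 ≤ q.1 ∧ (p.1 = q.1 → (p.2 : ℕ) ≤ q.2) := by
  -- Extending the block lengths by zero turns positions into sums over `Finset.range`.
  let ν' : ℕ → ℕ := fun t => if ht : t < s then ν ⟨t, ht⟩ else 0
  have hval : ∀ p : Σ i, Fin (ν i),
      (finSigmaFinEquiv p : ℕ) = ∑ t ∈ Finset.range p.1, ν' t + p.2 := fun p => by
    rw [finSigmaFinEquiv_apply, ← Fin.sum_univ_eq_sum_range]
    congr 1
    refine Finset.sum_congr rfl fun i _ => ?_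
    rw [show ν' i = ν ⟨i, _⟩ from dif_pos (i.2.trans p.1.2)]
    rfl
  rw [Fin.le_def, hval, hval] at h
  refine ⟨not_lt.1 fun hlt => ?_, fun heq => ?_⟩
  · have h1 : ∑ t ∈ Finset.range (q.1 + 1), ν' t ≤ ∑ t ∈ Finset.range p.1, ν' t :=
      Finset.sum_le_sum_of_subset (Finset.range_mono hlt)
    rw [Finset.sum_range_succ, show ν' q.1 = ν q.1 from dif_pos q.1.2] at h1
    have := q.2.2
    omega
  · rw [show (p.1 : ℕ) = q.1 from congrArg Fin.val heq] at h
    omega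

theorem antitone_blockSeq {s : ℕ} {ν : Fin s → ℕ} {c : (i : Fin s) → Fin (ν i) → ℤ}
    (h1 : ∀ i, Antitone (c i)) (h2 : ∀ i k, i < k → ∀ j l, c k l ≤ c i j) :
    Antitone (blockSeq ν c) := by
  intro j l hjl
  obtain ⟨hik, hjl⟩ := lex_of_finSigmaFinEquiv_le (p := finSigmaFinEquiv.symm j)
    (q := finSigmaFinEquiv.symm l) (by simpa using hjl)
  simp only [blockSeq]
  generalize finSigmaFinEquiv.symm j = p at *
  generalize finSigmaFinEquiv.symm l = q at *
  obtain ⟨i, j⟩ := p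
  obtain ⟨k, l⟩ := q
  rcases hik.eq_or_lt with h | h
  · obtain rfl : i = k := h
    exact h1 i (hjl rfl)
  · exact h2 i k h j l

/-- For integers, `α k < α i` gives `α k ≤ α i - 1`, so lowering block `i` by one never puts it
below a later block. -/
theorem antitone_blockSeq_ite {s : ℕ} {ν : Fin s → ℕ} {α : Fin s → ℤ} (hα : StrictAnti α)
    (m : Fin s → ℕ) :
    Antitone (blockSeq ν fun i j => if (j : ℕ) < m i then α i else α i - 1) := by
  refine antitone_blockSeq (fun i j l hjl => ?_) fun i k hik j l => ?_
  · have : (j : ℕ) ≤ l := hjl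
    split_ifs <;> omega
  · have := hα hik
    split_ifs <;> omega

end RiemannSphere

end

/-! ### The theorem -/

open RiemannSphere in
theorem mainTheorem2 {s : ℕ} (ν : Fin s → ℕ) (α : Fin s → ℤ) (hα : StrictAnti α)
    (E : RiemannSphere.OMod)
    (φ : E ≅ RiemannSphere.splitBundle (RiemannSphere.blockSeq ν fun i _ => α i))
    (x : RiemannSphere.P1)
    (Λ : Submodule (RiemannSphere.StalkO x) (RiemannSphere.Stalk E x))
    (hΛ : RiemannSphere.maxIdeal x •
      (⊤ : Submodule (RiemannSphere.StalkO x) (RiemannSphere.Stalk E x)) ≤ Λ) :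
    (∀ i, RiemannSphere.flagDim φ α Λ i.castSucc ≤ RiemannSphere.flagDim φ α Λ i.succ ∧
        RiemannSphere.flagMult φ α Λ i ≤ ν i) ∧
      RiemannSphere.HasType (RiemannSphere.modify E x Λ)
        (RiemannSphere.blockSeq ν fun i j =>
          if (j : ℕ) < RiemannSphere.flagMult φ α Λ i then α i else α i - 1) := by
  set e : Fin (∑ i, ν i) ≃ Σ i, Fin (ν i) := finSigmaFinEquiv.symm with he
  set W := latticeSpace φ Λ
  have hdim : ∀ i, flagDim φ α Λ i = blockDim e W i :=
    flagDim_eq φ hα (b := fun j => (e j).1) (fun _ => rfl) Λ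
  have hmult : ∀ i, flagMult φ α Λ i = blockDim e W (i + 1) - blockDim e W i := fun i => by
    rw [flagMult, hdim, hdim]
    rfl
  refine ⟨fun i => ⟨?_, ?_⟩, antitone_blockSeq_ite hα _, ?_⟩
  -- This makes the natural subtraction in `flagMult` a true difference.
  · rw [hdim, hdim]
    exact blockDim_mono e W i
  · rw [hmult]
    exact blockDim_sub_le e W i
  · obtain ⟨c, hc, htri, hJ, hJ'⟩ := exists_blockTriangular_adapted e W
    have hinv := hc.invertible
    -- Triangularity of the inverse makes the inverse twist holomorphic as well.
    have htri' := Matrix.blockTriangular_inv_of_blockTriangular htri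
    have hmono : ∀ {c : Matrix _ _ ℂ}, c.BlockTriangular (fun j => (e j).1) →
        ∀ k j, c k j ≠ 0 → α (e j).1 ≤ α (e k).1 := fun h k j hkj =>
      hα.antitone (not_lt.1 fun hlt => hkj (h hlt))
    refine nonempty_iso_splitBundle φ hΛ (Matrix.mul_inv_of_invertible c) (hmono htri)
      (hmono htri') (fun j => ((e j).2 : ℕ) < flagMult φ α Λ (e j).1) (fun j hj => hJ j ?_)
      (fun t ht j hj => hJ' t ht j ?_) (fun j hj => if_pos hj)
      (fun j hj => if_neg hj)
    · rwa [← hmult]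
    · rw [← hmult]
      exact not_lt.1 hj
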